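/- Let $\mathscr V$ be a complete separable metric space, let $\nu$ be a boundedly finite Borel measure on $\mathscr V$ (finite on bounded sets), and let $\mathbb M$ be the space of boundedly finite Borel measures on $\mathscr V$ with the $\sigma$-algebra generated by the maps $m\mapsto m(B)$, $B$ Borel. Write $\mathbb P(dN\mid\nu)$ for the law on $\mathbb M$ of a Poisson random measure with mean intensity $\nu$. Let $f_1,\dots,f_n:\mathscr V\to[0,\infty)$ be measurable, let $\mu,\Delta,\beta\in\mathbb R$, let $N$ be a Poisson random measure with law $\mathbb P(dN\mid\nu)$, put $\tau_i=N(f_i)=\int f_i\,dN$, and assume that $0<\tau_i<\infty$ almost surely for each $i$. Let $X=(X_1,\dots,X_n)$ be random variables which, given $N$, are independent with $X_i$ normal with mean $\mu\Delta+\beta\tau_i$ and variance $\tau_i$, and let $\phi(\cdot\mid a,v)$ be the normal density with mean $a$ and variance $v$. For $x\in\mathbb R^n$ and $y\in\mathbb R_+^n=[0,\infty)^n$ put $$A_i=x_i-\mu\Delta,\qquad \Omega_n(v)=\sum_{i=1}^n\Big(\frac{y_i^2}{2}+\frac{\beta^2}{2}\Big)f_i(v),\qquad \Lambda(g)=\int_{\mathscr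 V}(1-e^{-g(v)})\,\nu(dv),$$ $$\nu_{\Omega_n}(dv)=e^{-\Omega_n(v)}\nu(dv),\qquad \mathscr L(x)=\mathbb E\Big[\prod_{i=1}^n\phi(x_i\mid\mu\Delta+\beta\tau_i,\tau_i)\Big],$$ $$\mathscr Q_x(dy)=q_x(y)\,dy,\qquad q_x(y)=\frac{1}{\pi^{n}\mathscr L(x)}\,e^{-\Lambda(\Omega_n)+\beta\sum_{i=1}^nA_i}\prod_{i=1}^n\cos(y_i|A_i|).$$ **Theorem 2.2.** For every $y$ the law $\mathbb P(dN\mid\nu_{\Omega_n})$ of a Poisson random measure with mean intensity $\nu_{\Omega_n}$ exists, and it is a measurable function of $y$. Almost surely $X_i\neq\mu\Delta$ for all $i$. There is a version $\kappa(x,dN)$ of the regular conditional distribution of $N$ given $X$ (the posterior distribution of $N\mid X$) with the following properties. 1. For every $x$ with $x_i\ne\mu\Delta$ for all $i$ (hence for almost every value of the data) one has $\mathscr L(x)>0$ and $$\kappa(x,B)=\int_{\mathbb R_+^n}\mathbb P(B\mid\nu_{\Omega_n})\,\mathscr Q_x(dy)\qquad\text{for all measurable }B\subseteq\mathbb M,$$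 where the integral is an improper one: the limit of the integrals over $\prod_i[0,R_i]$ as all $R_i\to\infty$. 2. If $\int_{\mathbb R_+^n}e^{-\Lambda(\Omega_n)}dy<\infty$, then for every $x\in\mathbb R^n$ one has $\mathscr L(x)>0$, $\mathscr Q_x$ is a finite signed measure, and the formula for $\kappa(x,B)$ holds with an absolutely convergent integral. 3. The posterior distribution of $\tau=(\tau_1,\dots,\tau_n)$ given $X=x$ is the image of $\kappa(x,\cdot)$ under $m\mapsto(m(f_1),\dots,m(f_n))$. 4. $\mathbb P(dN\mid\nu_{\Omega_n})$ is the posterior distribution of $N$ given $x$ and $y$ in the following sense. Let $$\psi(x,y\mid m)=\prod_{i=1}^n\pi^{-1}e^{A_i\beta}\cos(y_i|A_i|)\,e^{-(y_i^2/2+\beta^2/2)\,m(f_i)} .$$ For every $x$ and for $\mathbb P(dN\mid\nu)$-almost every $m$, the function $y\mapsto\psi(x,y\mid m)$ is integrable over $\mathbb R_+^n$ with $\int_{\mathbb R_+^n}\psi(x,y\mid m)\,dy=\prod_i\phi(x_i\mid\mu\Delta+\beta m(f_i),m(f_i))$. For all $x$, $y$ and all measurable $B\subseteq\mathbb M$,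 $$\int_B\psi(x,y\mid m)\,\mathbb P(dm\mid\nu)=\mathbb P(B\mid\nu_{\Omega_n})\;\pi^{-n}e^{-\Lambda(\Omega_n)+\beta\sum_iA_i}\prod_{i=1}^n\cos(y_i|A_i|).$$ -/

import Mathlib

open MeasureTheory ProbabilityTheory Filter Topology
open scoped NNReal ENNReal

noncomputable section

namespace PoissonSV

/-- The space of boundedly finite measures on `V`, with the σ-algebra generated by the
evaluation maps `m ↦ m B`, `B` measurable. -/
abbrev BFMeasure (V : Type*) [MetricSpace V] [MeasurableSpace V] : Type _ :=
  {m : Measure V // ∀ s : Set V, Bornology.IsBounded s → m s < ∞}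

section

variable {V : Type*} [MetricSpace V] [MeasurableSpace V]

/-- `Q` is the law of a Poisson random measure with mean intensity `ν`: under `Q(dm)` the mass
`m B` is Poisson distributed with mean `ν B` (for `ν B` finite), and the masses of finitely many
pairwise disjoint measurable sets are independent. -/
structure IsPoissonLaw (ν : Measure V) (Q : Measure (BFMeasure V)) : Prop where
  count : ∀ B : Set V, MeasurableSet B → ν B ≠ ∞ →
    Q.map (fun m : BFMeasure V => m.1 B)
      = (poissonMeasure (ν B).toNNReal).map (fun k : ℕ => (k : ℝ≥0∞))
  indep : ∀ (k : ℕ) (B : Fin k → Set V), (∀ j, MeasurableSet (B j)) →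
    Pairwise (fun i j => Disjoint (B i) (B j)) →
    iIndepFun (fun (j : Fin k) (m : BFMeasure V) => m.1 (B j)) Q

/-- The linear functional `m(g) = ∫ g dm` of a measure `m`. -/
def lin (g : V → ℝ≥0) (m : BFMeasure V) : ℝ≥0∞ := ∫⁻ x, (g x : ℝ≥0∞) ∂m.1

lemma measurable_lin {g : V → ℝ≥0} (hg : Measurable g) :
    Measurable (lin g : BFMeasure V → ℝ≥0∞) :=
  (Measure.measurable_lintegral hg.coe_nnreal_ennreal).comp measurable_subtype_coe

/-- `Λ(g) = ∫ (1 - e^{-g}) dν`. -/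
def Lam (ν : Measure V) (g : V → ℝ) : ℝ := ∫ x, (1 - Real.exp (-g x)) ∂ν

/-- The measure `ν_g(dx) = e^{-g(x)} ν(dx)`. -/
def tilt (ν : Measure V) (g : V → ℝ) : Measure V :=
  ν.withDensity (fun x => ENNReal.ofReal (Real.exp (-g x)))

/-- `Ω_n(x) = ∑ i, (y_i² / 2 + β² / 2) f_i(x)`. -/
def Omega {n : ℕ} (β : ℝ) (f : Fin n → V → ℝ≥0) (y : Fin n → ℝ) (x : V) : ℝ :=
  ∑ i, (y i ^ 2 / 2 + β ^ 2 / 2) * (f i x : ℝ)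

lemma measurable_pi_gaussianReal {α : Type*} [MeasurableSpace α] {n : ℕ}
    {a : Fin n → α → ℝ} {v : Fin n → α → ℝ≥0}
    (ha : ∀ i, Measurable (a i)) (hv : ∀ i, Measurable (v i)) :
    Measurable (fun m => Measure.pi (fun i => gaussianReal (a i m) (v i m))) := by
  refine Measurable.measure_of_isPiSystem_of_isProbabilityMeasure
    generateFrom_pi.symm isPiSystem_pi ?_
  rintro _ ⟨s, hs, rfl⟩
  simp_rw [Measure.pi_pi]
  refine Finset.measurable_prod _ (fun i _ => ?_)
  have h1 : Measurable (fun m => gaussianReal (a i m) (v i m)) :=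
    measurable_gaussianReal.comp ((ha i).prodMk (hv i))
  have h2 : MeasurableSet (s i) := hs i (Set.mem_univ i)
  exact (Measure.measurable_coe h2).comp h1

/-- The sampling model: given `N = m`, the returns `X_1, …, X_n` are independent and `X_i` is
normal with mean `μ Δ + β τ_i` and variance `τ_i`, where `τ_i = m(f_i)`. -/
def sampling {n : ℕ} (μ Δ β : ℝ) (f : Fin n → V → ℝ≥0) (hf : ∀ i, Measurable (f i)) :
    Kernel (BFMeasure V) (Fin n → ℝ) where
  toFun m := Measure.pi fun i =>
    gaussianReal (μ * Δ + β * (lin (f i) m).toReal) (lin (f i) m).toNNReal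
  measurable' := measurable_pi_gaussianReal
    (fun i => (measurable_const.add (measurable_const.mul (measurable_lin (hf i)).ennreal_toReal)))
    (fun i => (measurable_lin (hf i)).ennreal_toNNReal)

/-- The conditional density `∏ i, φ(x_i | μ Δ + β τ_i, τ_i)` of the data `x` given `N = m`. -/
def condDensity {n : ℕ} (μ Δ β : ℝ) (f : Fin n → V → ℝ≥0) (x : Fin n → ℝ)
    (m : BFMeasure V) : ℝ :=
  ∏ i, gaussianPDFReal (μ * Δ + β * (lin (f i) m).toReal) (lin (f i) m).toNNReal (x i)

/-- The likelihood `ℒ(x | μ, β)`: the integral of the conditional density against the law of the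
random measure. -/
def likelihood {n : ℕ} (P : Measure (BFMeasure V)) (μ Δ β : ℝ) (f : Fin n → V → ℝ≥0)
    (x : Fin n → ℝ) : ℝ :=
  ∫ m, condDensity μ Δ β f x m ∂P

/-- The weight `π^{-n} exp(-[Λ(Ω_n) - n Ā β]) ∏ i, cos(y_i |A_i|)` with `A_i = x_i - μ Δ`
and `n Ā = ∑ i, A_i`. -/
def weight {n : ℕ} (ν : Measure V) (μ Δ β : ℝ) (f : Fin n → V → ℝ≥0) (x y : Fin n → ℝ) : ℝ :=
  (Real.pi ^ n)⁻¹ * Real.exp (-(Lam ν (Omega β f y) - (∑ i, (x i - μ * Δ)) * β))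
    * ∏ i, Real.cos (y i * |x i - μ * Δ|)

/-- The density with respect to `dy` of the signed mixing measure `𝒬_x(dy)`; here `P` is the
law of the random measure. -/
def mixDensity {n : ℕ} (ν : Measure V) (P : Measure (BFMeasure V)) (μ Δ β : ℝ)
    (f : Fin n → V → ℝ≥0) (x y : Fin n → ℝ) : ℝ :=
  weight ν μ Δ β f x y / likelihood P μ Δ β f x

/-- The (signed) likelihood of `m` given the data `x` and the auxiliary variable `y`:
`∏ i, π^{-1} e^{A_i β} cos(y_i |A_i|) e^{-(y_i² / 2 + β² / 2) m(f_i)}`. -/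
def augmented {n : ℕ} (μ Δ β : ℝ) (f : Fin n → V → ℝ≥0) (x y : Fin n → ℝ)
    (m : BFMeasure V) : ℝ :=
  ∏ i, (Real.pi⁻¹ * Real.exp ((x i - μ * Δ) * β) * Real.cos (y i * |x i - μ * Δ|)
    * Real.exp (-((y i ^ 2 / 2 + β ^ 2 / 2) * (lin (f i) m).toReal)))

end

end PoissonSV

end

/-! Three facts carry the theorem. With `A = x - μΔ` and `τ > 0`, the Fourier transform of the
Gaussian gives `φ(x | μΔ + βτ, τ) = π⁻¹ e^{Aβ} ∫_0^∞ cos(y|A|) e^{-(y²+β²)τ/2} dy`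
(`setIntegral_Ici_augmentedFactor`), so the dependence of the sampling density on `m` is turned into
a mixture of the exponentials `e^{-m(Ω_n)}`. Next, weighting a Poisson law by `e^{-m(g)}` and
normalising gives the Poisson law with intensity `e^{-g} ν`, and for `g = Ω_n` the normaliser is
`e^{-Λ(Ω_n)}` (`IsPoissonLaw.withDensity_expNeg`, `normalizer_eq_exp_neg_Lam`). This is proved with
Laplace functionals, which characterise Poisson laws. Finally, Bayes' formula writes the posterior
as the prior weighted by the sampling density (`hasCondDistrib_posteriorKernel`); the mixture
representation is then an interchange of the integrals over `y` and `m`.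

The interchange is the delicate point. If `e^{-Λ(Ω_n)}` is integrable over the orthant, Fubini
applies at once, for every `x`. Otherwise Fubini is applied on boxes, where the integrand is
bounded, and the box is sent to infinity inside the integral over `m`. Dominated convergence is
available because integration by parts bounds the truncated cosine integral by `|A|⁻¹`, uniformly in
`τ` and in the box (`abs_setIntegral_Icc_cos_mul_exp_neg_sq_le`). This is where `x_i ≠ μΔ` is
needed, and it also gives a finite likelihood. -/

noncomputable section

namespace PoissonSV

/-! ### Laplace transforms on `[0, ∞]`. -/

/-- The function `x ↦ e^{-x}` on `[0, ∞]`, with `e^{-∞} = 0`. -/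
def expNeg (x : ℝ≥0∞) : ℝ≥0∞ := EReal.exp (-(x : EReal))

@[simp] lemma expNeg_zero : expNeg 0 = 1 := by simp [expNeg]

@[simp] lemma expNeg_top : expNeg ∞ = 0 := by simp [expNeg]

lemma expNeg_ofReal {r : ℝ} (hr : 0 ≤ r) :
    expNeg (ENNReal.ofReal r) = ENNReal.ofReal (Real.exp (-r)) := by
  rw [expNeg, EReal.coe_ennreal_ofReal, max_eq_left hr, ← EReal.coe_neg, EReal.exp_coe]

lemma expNeg_of_ne_top {x : ℝ≥0∞} (hx : x ≠ ∞) :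
    expNeg x = ENNReal.ofReal (Real.exp (-x.toReal)) := by
  rw [← expNeg_ofReal ENNReal.toReal_nonneg, ENNReal.ofReal_toReal hx]

lemma expNeg_add (x y : ℝ≥0∞) : expNeg (x + y) = expNeg x * expNeg y := by
  rw [expNeg, expNeg, expNeg, EReal.coe_ennreal_add, EReal.neg_add, sub_eq_add_neg,
    EReal.exp_add]
  · left; simp
  · right; simp

lemma expNeg_le_one (x : ℝ≥0∞) : expNeg x ≤ 1 := by
  simpa [expNeg] using EReal.coe_ennreal_nonneg x

lemma expNeg_ne_top (x : ℝ≥0∞) : expNeg x ≠ ∞ := ne_top_of_le_ne_top ENNReal.one_ne_top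
  (expNeg_le_one x)

lemma expNeg_eq_zero {x : ℝ≥0∞} : expNeg x = 0 ↔ x = ∞ := by
  simp [expNeg]

lemma expNeg_injective : Function.Injective expNeg := fun x y h => by
  simpa using EReal.exp_strictMono.injective h

lemma expNeg_antitone : Antitone expNeg := fun x y h => by
  simpa [expNeg] using h

lemma continuous_expNeg : Continuous expNeg :=
  ENNReal.continuous_exp.comp (continuous_neg.comp continuous_coe_ennreal_ereal)

lemma measurable_expNeg : Measurable expNeg := continuous_expNeg.measurable

lemma expNeg_sum {ι : Type*} (s : Finset ι) (g : ι → ℝ≥0∞) :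
    expNeg (∑ i ∈ s, g i) = ∏ i ∈ s, expNeg (g i) := by
  classical
  induction s using Finset.induction_on with
  | empty => simp
  | insert a s ha ih => rw [Finset.sum_insert ha, Finset.prod_insert ha, expNeg_add, ih]

lemma expNeg_natCast_mul (k : ℕ) (x : ℝ≥0∞) : expNeg (k * x) = expNeg x ^ k := by
  induction k with
  | zero => simp
  | succ k ih => rw [Nat.cast_succ, add_mul, one_mul, expNeg_add, ih, pow_succ]

/-- Summing the exponential series gives `e^{-r} e^{sr}`, the probability generating function of the
Poisson law. -/
lemma lintegral_pow_poissonMeasure (r : ℝ≥0) {s : ℝ≥0∞} (hs : s ≤ 1) :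
    ∫⁻ k, s ^ k ∂(poissonMeasure r) = expNeg ((1 - s) * r) := by
  lift s to ℝ≥0 using ne_top_of_le_ne_top ENNReal.one_ne_top hs
  have hs' : (s : ℝ) ≤ 1 := by exact_mod_cast hs
  have h1 : ((1 : ℝ≥0∞) - s) * r = ENNReal.ofReal ((1 - s : ℝ) * r) := by
    rw [ENNReal.ofReal_mul (by linarith), ENNReal.ofReal_sub _ s.coe_nonneg]
    simp
  rw [h1, expNeg_ofReal (mul_nonneg (by linarith) r.coe_nonneg), poissonMeasure,
    lintegral_sum_measure]
  have h2 : ∀ k : ℕ, ∫⁻ a, (s : ℝ≥0∞) ^ a ∂(ENNReal.ofReal (Real.exp (-r) * r ^ k / k.factorial)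
      • Measure.dirac k) = ENNReal.ofReal (Real.exp (-r) * ((s * r : ℝ) ^ k / k.factorial)) := by
    intro k
    rw [lintegral_smul_measure, lintegral_dirac, smul_eq_mul, ← ENNReal.ofReal_coe_nnreal,
      ← ENNReal.ofReal_pow s.coe_nonneg, ← ENNReal.ofReal_mul (by positivity)]
    congr 1
    rw [mul_pow]
    ring
  simp_rw [h2]
  have h3 : HasSum (fun k : ℕ => Real.exp (-r) * ((s * r : ℝ) ^ k / k.factorial))
      (Real.exp (-r) * Real.exp (s * r)) := by
    have h4 := NormedSpace.expSeries_div_hasSum_exp (𝔸 := ℝ) (s * r)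
    rw [← Real.exp_eq_exp_ℝ] at h4
    exact h4.mul_left _
  rw [← ENNReal.ofReal_tsum_of_nonneg (fun k => by positivity) h3.summable, h3.tsum_eq,
    ← Real.exp_add]
  congr 2
  ring

/-- Finite measures on `[0, ∞]^ι` are determined by their Laplace transform at integer points. -/
lemma ext_of_laplace {ι : Type*} [Fintype ι] {P P' : Measure (ι → ℝ≥0∞)}
    [IsFiniteMeasure P] [IsFiniteMeasure P']
    (h : ∀ t : ι → ℕ, ∫⁻ x, ∏ i, expNeg (x i) ^ t i ∂P = ∫⁻ x, ∏ i, expNeg (x i) ^ t i ∂P') :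
    P = P' := by
  have hcont : ∀ i : ι, Continuous fun x : ι → ℝ≥0∞ => (expNeg (x i)).toReal := fun i =>
    ENNReal.continuousOn_toReal.comp_continuous (continuous_expNeg.comp (continuous_apply i))
      fun x => expNeg_ne_top _
  let e : ι → BoundedContinuousFunction (ι → ℝ≥0∞) ℝ := fun i =>
    BoundedContinuousFunction.mkOfCompact ⟨_, hcont i⟩
  have he : ∀ i x, e i x = (expNeg (x i)).toReal := fun i x => rfl
  -- The functions `e^{-x_i}` are bounded, continuous and jointly injective on `[0, ∞]^ι`, so the
  -- algebra they generate separates points and determines a finite measure. It is spanned by the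
  -- monomials in the hypothesis; the star operation adds nothing over `ℝ`.
  refine ext_of_forall_mem_subalgebra_integral_eq_of_polish
    (A := StarAlgebra.adjoin ℝ (Set.range e)) ?_ ?_
  · intro x y hxy
    obtain ⟨i, hi⟩ := Function.ne_iff.1 hxy
    refine ⟨fun z => e i z, ⟨⟨_, hcont i⟩, ?_, rfl⟩, ?_⟩
    · exact ⟨e i, StarAlgebra.subset_adjoin ℝ _ ⟨i, rfl⟩, rfl⟩
    · intro h'
      exact hi (expNeg_injective
        ((ENNReal.toReal_eq_toReal_iff' (expNeg_ne_top _) (expNeg_ne_top _)).1 h'))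
  · intro g hg
    have hmono : ∀ g ∈ Submonoid.closure (Set.range e ∪ star (Set.range e)),
        ∃ t : ι → ℕ, g = ∏ i, e i ^ t i := by
      intro g hg
      induction hg using Submonoid.closure_induction with
      | mem g hg =>
        classical
        have : ∃ i, e i = g := by
          rcases hg with ⟨i, hi⟩ | hg
          · exact ⟨i, hi⟩
          · obtain ⟨i, hi⟩ := hg
            refine ⟨i, ?_⟩
            ext x
            have := congrArg (fun u => u x) hi
            simpa using this
        obtain ⟨i, rfl⟩ := this
        refine ⟨Pi.single i 1, ?_⟩
        rw [Finset.prod_eq_single i (fun j _ hj => by simp [hj]) (by simp)]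
        simp
      | one => exact ⟨0, by simp⟩
      | mul a b _ _ ha hb =>
        obtain ⟨s, rfl⟩ := ha
        obtain ⟨t, rfl⟩ := hb
        exact ⟨s + t, by simp [pow_add, Finset.prod_mul_distrib]⟩
    have key : ∀ (ρ : Measure (ι → ℝ≥0∞)) [IsFiniteMeasure ρ] (t : ι → ℕ),
        ∫ x, (∏ i, (e i) ^ (t i)) x ∂ρ =
          (∫⁻ x, ∏ i, expNeg (x i) ^ t i ∂ρ).toReal := by
      intro R _ t
      rw [← integral_toReal]
      · refine integral_congr_ae (Eventually.of_forall fun x => ?_)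
        simp [ENNReal.toReal_prod, he]
      · exact (Finset.measurable_prod _ fun i _ =>
          ((measurable_expNeg.comp (measurable_pi_apply i)).pow_const _)).aemeasurable
      · exact Eventually.of_forall fun x => ENNReal.prod_lt_top fun i _ =>
          ENNReal.pow_lt_top (expNeg_ne_top _).lt_top
    have hg' : g ∈ Submodule.span ℝ
        (Submonoid.closure (Set.range e ∪ star (Set.range e)) :
          Set (BoundedContinuousFunction (ι → ℝ≥0∞) ℝ)) := by
      rw [← StarAlgebra.adjoin_eq_span]
      exact hg
    clear hg
    induction hg' using Submodule.span_induction with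
    | mem g hg =>
      obtain ⟨t, rfl⟩ := hmono g hg
      rw [key, key, h]
    | zero => simp
    | add a b _ _ ha hb =>
      simp only [BoundedContinuousFunction.coe_add, Pi.add_apply]
      rw [integral_add (a.integrable _) (b.integrable _),
        integral_add (a.integrable _) (b.integrable _), ha, hb]
    | smul c a _ ha =>
      simp only [BoundedContinuousFunction.coe_smul, smul_eq_mul]
      rw [integral_const_mul, integral_const_mul, ha]

/-! ### The Laplace functional of a Poisson random measure. -/

section

variable {V : Type*} [MetricSpace V] [MeasurableSpace V]

lemma measurable_eval {B : Set V} (hB : MeasurableSet B) :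
    Measurable (fun m : BFMeasure V => m.1 B) :=
  (Measure.measurable_coe hB).comp measurable_subtype_coe

lemma measurable_lintegral_bfMeasure {g : V → ℝ≥0∞} (hg : Measurable g) :
    Measurable (fun m : BFMeasure V => ∫⁻ x, g x ∂m.1) :=
  (Measure.measurable_lintegral hg).comp measurable_subtype_coe

lemma measurable_expNeg_lintegral {g : V → ℝ≥0∞} (hg : Measurable g) :
    Measurable (fun m : BFMeasure V => expNeg (∫⁻ x, g x ∂m.1)) :=
  measurable_expNeg.comp (measurable_lintegral_bfMeasure hg)

lemma IsPoissonLaw.isProbabilityMeasure {ν : Measure V} {Q : Measure (BFMeasure V)}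
    (h : IsPoissonLaw ν Q) : IsProbabilityMeasure Q :=
  (h.indep 0 (fun _ => ∅) (fun _ => MeasurableSet.empty)
    (fun i => i.elim0)).isProbabilityMeasure

lemma lintegral_expNeg_mul_of_map_eq_poisson {Q : Measure (BFMeasure V)} {B : Set V}
    (hB : MeasurableSet B) {r : ℝ≥0}
    (h : Q.map (fun m : BFMeasure V => m.1 B)
      = (poissonMeasure r).map (fun k : ℕ => (k : ℝ≥0∞))) (c : ℝ≥0∞) :
    ∫⁻ m, expNeg (c * m.1 B) ∂Q = expNeg ((1 - expNeg c) * r) := by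
  have hm : Measurable fun x : ℝ≥0∞ => expNeg (c * x) :=
    measurable_expNeg.comp (measurable_const_mul c)
  rw [← lintegral_map (f := fun x => expNeg (c * x)) hm (measurable_eval hB), h,
    lintegral_map hm (measurable_of_countable _)]
  simp_rw [mul_comm c, expNeg_natCast_mul]
  exact lintegral_pow_poissonMeasure r (expNeg_le_one c)

/-- The integral `m(φ)` is a combination of the masses of the disjoint fibres of `φ`, which are
independent, so the expectation factors into Poisson transforms. The fibre over `0` may have
infinite intensity, but its factor is `1` on both sides. -/
lemma IsPoissonLaw.lintegral_expNeg_simpleFunc {ν : Measure V} {Q : Measure (BFMeasure V)}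
    (h : IsPoissonLaw ν Q) (φ : SimpleFunc V ℝ≥0∞)
    (hφ : ∀ c, c ≠ 0 → ν (φ ⁻¹' {c}) ≠ ∞) :
    ∫⁻ m, expNeg (∫⁻ x, φ x ∂m.1) ∂Q = expNeg (∫⁻ x, (1 - expNeg (φ x)) ∂ν) := by
  have := h.isProbabilityMeasure
  let e := φ.range.equivFin.symm
  have hsum : ∀ F : ℝ≥0∞ → ℝ≥0∞, ∑ c ∈ φ.range, F c = ∑ j, F (e j) := fun F => by
    rw [← Finset.sum_coe_sort]
    exact (e.sum_comp fun c => F c).symm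
  have hmeas : ∀ j, MeasurableSet (φ ⁻¹' {(e j : ℝ≥0∞)}) := fun j => φ.measurableSet_fiber _
  have hdisj : Pairwise fun i j => Disjoint (φ ⁻¹' {(e i : ℝ≥0∞)}) (φ ⁻¹' {(e j : ℝ≥0∞)}) := by
    intro i j hij
    refine Disjoint.preimage _ (Set.disjoint_singleton.2 fun h' => hij ?_)
    exact e.injective (Subtype.ext h')
  have hind := h.indep _ (fun j => φ ⁻¹' {(e j : ℝ≥0∞)}) hmeas hdisj
  have hind' := hind.comp (fun j x => expNeg ((e j : ℝ≥0∞) * x))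
    fun j => measurable_expNeg.comp (measurable_const_mul _)
  have h1 : ∀ m : BFMeasure V, expNeg (∫⁻ x, φ x ∂m.1)
      = ∏ j, expNeg ((e j : ℝ≥0∞) * m.1 (φ ⁻¹' {(e j : ℝ≥0∞)})) := by
    intro m
    rw [← expNeg_sum, ← hsum (fun c => c * m.1 (φ ⁻¹' {c})), SimpleFunc.lintegral_eq_lintegral]
    rfl
  simp_rw [h1]
  have h2 : ∫⁻ m : BFMeasure V, ∏ j, expNeg ((e j : ℝ≥0∞) * m.1 (φ ⁻¹' {(e j : ℝ≥0∞)})) ∂Q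
      = ∏ j, ∫⁻ m : BFMeasure V, expNeg ((e j : ℝ≥0∞) * m.1 (φ ⁻¹' {(e j : ℝ≥0∞)})) ∂Q :=
    lintegral_prod_eq_prod_lintegral_of_indepFun Finset.univ _ hind' fun j =>
      measurable_expNeg.comp ((measurable_const_mul _).comp (measurable_eval (hmeas j)))
  rw [h2]
  have h3 : ∫⁻ x, (1 - expNeg (φ x)) ∂ν
      = ∑ j, (1 - expNeg (e j)) * ν (φ ⁻¹' {(e j : ℝ≥0∞)}) := by
    rw [← hsum (fun c => (1 - expNeg c) * ν (φ ⁻¹' {c})), ← SimpleFunc.map_lintegral,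
      ← SimpleFunc.lintegral_eq_lintegral]
    rfl
  rw [h3, expNeg_sum]
  refine Finset.prod_congr rfl fun j _ => ?_
  by_cases hj : (e j : ℝ≥0∞) = 0
  · simp [hj]
  · rw [lintegral_expNeg_mul_of_map_eq_poisson (hmeas j) (h.count _ (hmeas j) (hφ _ hj)),
      ENNReal.coe_toNNReal (hφ _ hj)]

/-- The Laplace functional of a Poisson random measure. -/
lemma IsPoissonLaw.lintegral_expNeg {ν : Measure V} [SigmaFinite ν] {Q : Measure (BFMeasure V)}
    (h : IsPoissonLaw ν Q) {g : V → ℝ≥0∞} (hg : Measurable g) :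
    ∫⁻ m, expNeg (∫⁻ x, g x ∂m.1) ∂Q = expNeg (∫⁻ x, (1 - expNeg (g x)) ∂ν) := by
  have := h.isProbabilityMeasure
  -- Restriction to the spanning sets makes every fibre over a nonzero value of finite intensity and
  -- keeps the sequence increasing to `g`.
  let φ : ℕ → SimpleFunc V ℝ≥0∞ := fun n =>
    (SimpleFunc.eapprox g n).restrict (spanningSets ν n)
  have hval : ∀ n x, φ n x = (spanningSets ν n).indicator (SimpleFunc.eapprox g n) x := fun n x =>
    SimpleFunc.restrict_apply _ (measurableSet_spanningSets ν n) x
  have hfin : ∀ n c, c ≠ 0 → ν (φ n ⁻¹' {c}) ≠ ∞ := by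
    intro n c hc
    refine ((measure_mono ?_).trans_lt (measure_spanningSets_lt_top ν n)).ne
    intro x hx
    by_contra hx'
    apply hc
    have : φ n x = c := hx
    rw [← this, hval, Set.indicator_of_notMem hx']
  have hmono : ∀ x, Monotone fun n => φ n x := by
    intro x i j hij
    simp only [hval]
    refine (Set.indicator_le_indicator (SimpleFunc.monotone_eapprox g hij x)).trans ?_
    exact Set.indicator_le_indicator_of_subset (monotone_spanningSets ν hij)
      (fun _ => bot_le) x
  have htend : ∀ x, Tendsto (fun n => φ n x) atTop (𝓝 (g x)) := by
    intro x
    have h1 := tendsto_atTop_iSup (f := fun n => SimpleFunc.eapprox g n x)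
      fun i j hij => SimpleFunc.monotone_eapprox g hij x
    rw [SimpleFunc.iSup_eapprox_apply hg] at h1
    refine h1.congr' ?_
    filter_upwards [eventually_mem_spanningSets ν x] with n hn
    rw [hval, Set.indicator_of_mem hn]
  have hL : Tendsto (fun n => ∫⁻ m : BFMeasure V, expNeg (∫⁻ x, φ n x ∂m.1) ∂Q) atTop
      (𝓝 (∫⁻ m, expNeg (∫⁻ x, g x ∂m.1) ∂Q)) := by
    refine tendsto_lintegral_of_dominated_convergence (fun _ => 1)
      (fun n => measurable_expNeg_lintegral (φ n).measurable)
      (fun n => Eventually.of_forall fun m => expNeg_le_one _) (by simp)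
      (Eventually.of_forall fun m => ?_)
    refine (continuous_expNeg.tendsto _).comp ?_
    exact lintegral_tendsto_of_tendsto_of_monotone (fun n => (φ n).measurable.aemeasurable)
      (Eventually.of_forall hmono) (Eventually.of_forall htend)
  have hR : Tendsto (fun n => expNeg (∫⁻ x, (1 - expNeg (φ n x)) ∂ν)) atTop
      (𝓝 (expNeg (∫⁻ x, (1 - expNeg (g x)) ∂ν))) := by
    refine (continuous_expNeg.tendsto _).comp ?_
    refine lintegral_tendsto_of_tendsto_of_monotone
      (fun n => (measurable_const.sub (measurable_expNeg.comp (φ n).measurable)).aemeasurable)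
      (Eventually.of_forall fun x i j hij =>
        tsub_le_tsub_left (expNeg_antitone (hmono x hij)) 1)
      (Eventually.of_forall fun x => ?_)
    exact ENNReal.Tendsto.sub tendsto_const_nhds
      ((continuous_expNeg.tendsto _).comp (htend x)) (Or.inl ENNReal.one_ne_top)
  refine tendsto_nhds_unique hL (hR.congr fun n => ?_)
  exact (h.lintegral_expNeg_simpleFunc (φ n) (hfin n)).symm

lemma lintegral_one_sub_expNeg_indicator {V : Type*} [MeasurableSpace V] {ν : Measure V} {B : Set V} (hB : MeasurableSet B)
    (c : ℝ≥0∞) :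
    ∫⁻ x, (1 - expNeg (B.indicator (fun _ => c) x)) ∂ν = (1 - expNeg c) * ν B := by
  rw [← lintegral_indicator_const hB]
  refine lintegral_congr fun x => ?_
  by_cases hx : x ∈ B <;> simp [hx]

/-- The Laplace functional characterises the law of a Poisson random measure. -/
lemma isPoissonLaw_of_lintegral_expNeg {ν : Measure V} {Q : Measure (BFMeasure V)}
    [IsProbabilityMeasure Q]
    (h : ∀ g : V → ℝ≥0∞, Measurable g →
      ∫⁻ m, expNeg (∫⁻ x, g x ∂m.1) ∂Q = expNeg (∫⁻ x, (1 - expNeg (g x)) ∂ν)) :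
    IsPoissonLaw ν Q := by
  have hone : ∀ B, MeasurableSet B → ∀ k : ℕ,
      ∫⁻ m : BFMeasure V, expNeg (m.1 B) ^ k ∂Q = expNeg ((1 - expNeg k) * ν B) := by
    intro B hB k
    rw [← lintegral_one_sub_expNeg_indicator hB, ← h _ (measurable_const.indicator hB)]
    refine lintegral_congr fun m => ?_
    rw [lintegral_indicator_const hB, expNeg_natCast_mul]
  refine ⟨fun B hB hνB => ?_, fun k B hB hdisj => ?_⟩
  -- A single mass is viewed as a vector indexed by `Unit`, so that the multivariate uniqueness
  -- result `ext_of_laplace` applies.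
  · have hu : Measurable fun x : ℝ≥0∞ => fun _ : Unit => x := by fun_prop
    have key : (Q.map (fun m : BFMeasure V => m.1 B)).map (fun x => fun _ : Unit => x)
        = ((poissonMeasure (ν B).toNNReal).map (fun k : ℕ => (k : ℝ≥0∞))).map
          (fun x => fun _ : Unit => x) := by
      have := Measure.isProbabilityMeasure_map (μ := Q) (measurable_eval hB).aemeasurable
      have : IsProbabilityMeasure
          ((poissonMeasure (ν B).toNNReal).map (fun k : ℕ => (k : ℝ≥0∞))) :=
        Measure.isProbabilityMeasure_map (measurable_of_countable _).aemeasurable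
      have := Measure.isFiniteMeasure_map (Q.map (fun m : BFMeasure V => m.1 B))
        (fun x => fun _ : Unit => x)
      have := Measure.isFiniteMeasure_map
        ((poissonMeasure (ν B).toNNReal).map (fun k : ℕ => (k : ℝ≥0∞)))
        (fun x => fun _ : Unit => x)
      refine ext_of_laplace fun t => ?_
      have hm : Measurable fun x : Unit → ℝ≥0∞ => ∏ i, expNeg (x i) ^ t i :=
        Finset.measurable_prod _ fun i _ =>
          (measurable_expNeg.comp (measurable_pi_apply i)).pow_const _
      rw [Measure.map_map hu (measurable_eval hB), Measure.map_map hu (measurable_of_countable _),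
        lintegral_map hm (hu.comp (measurable_eval hB)),
        lintegral_map hm (measurable_of_countable _)]
      simp only [Finset.univ_unique, Finset.prod_singleton, Function.comp_apply]
      rw [hone B hB]
      have hk : ∀ a : ℕ, expNeg (a : ℝ≥0∞) ^ t default = expNeg (t default : ℝ≥0∞) ^ a := by
        intro a
        rw [← expNeg_natCast_mul, ← expNeg_natCast_mul, mul_comm]
      simp_rw [hk]
      rw [lintegral_pow_poissonMeasure _ (expNeg_le_one _), ENNReal.coe_toNNReal hνB]
    have := congrArg (fun ρ => ρ.map fun u : Unit → ℝ≥0∞ => u ()) key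
    simpa [Measure.map_map (measurable_pi_apply ()) hu, Function.comp_def] using this
  · rw [iIndepFun_iff_map_fun_eq_pi_map fun j => (measurable_eval (hB j)).aemeasurable]
    have hev : Measurable fun (m : BFMeasure V) (j : Fin k) => m.1 (B j) :=
      measurable_pi_lambda _ fun j => measurable_eval (hB j)
    have := fun j => Measure.isProbabilityMeasure_map (μ := Q) (measurable_eval (hB j)).aemeasurable
    have := Measure.isProbabilityMeasure_map (μ := Q) hev.aemeasurable
    refine ext_of_laplace fun t => ?_
    have hm1 : ∀ i : Fin k, Measurable fun x : ℝ≥0∞ => expNeg x ^ t i := fun i =>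
      measurable_expNeg.pow_const _
    have hm : Measurable fun x : Fin k → ℝ≥0∞ => ∏ i, expNeg (x i) ^ t i :=
      Finset.measurable_prod _ fun i _ => (hm1 i).comp (measurable_pi_apply i)
    have hpi : ∫⁻ x, ∏ i, expNeg (x i) ^ t i
        ∂(Measure.pi fun j => Q.map fun m : BFMeasure V => m.1 (B j))
        = ∏ i, ∫⁻ m : BFMeasure V, expNeg (m.1 (B i)) ^ t i ∂Q := by
      have hI : iIndepFun (fun (j : Fin k) (x : Fin k → ℝ≥0∞) => expNeg (x j) ^ t j)
          (Measure.pi fun j => Q.map fun m : BFMeasure V => m.1 (B j)) :=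
        iIndepFun_pi (X := fun j x => expNeg x ^ t j) fun i => (hm1 i).aemeasurable
      rw [lintegral_prod_eq_prod_lintegral_of_indepFun Finset.univ _ hI
        fun i => (hm1 i).comp (measurable_pi_apply i)]
      refine Finset.prod_congr rfl fun i _ => ?_
      rw [← lintegral_map (hm1 i) (measurable_eval (hB i)),
        ← (measurePreserving_eval (fun j => Q.map fun m : BFMeasure V => m.1 (B j)) i).map_eq,
        lintegral_map (hm1 i) (measurable_pi_apply i)]
    rw [hpi, lintegral_map hm hev]
    -- By disjointness at most one indicator is nonzero at each point, so `1 - e^{-·}` is additive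
    -- on this sum. This is what makes the joint transform a product.
    have hsum : ∀ x, 1 - expNeg (∑ j, (B j).indicator (fun _ => (t j : ℝ≥0∞)) x)
        = ∑ j, (1 - expNeg ((B j).indicator (fun _ => (t j : ℝ≥0∞)) x)) := by
      intro x
      by_cases hx : ∃ j, x ∈ B j
      · obtain ⟨j, hj⟩ := hx
        have hj' : ∀ i, i ≠ j → x ∉ B i := fun i hi hxi =>
          Set.disjoint_left.1 (hdisj hi) hxi hj
        rw [Finset.sum_eq_single j (fun i _ hi => Set.indicator_of_notMem (hj' i hi) _)
            (by simp),
          Finset.sum_eq_single j (fun i _ hi => by simp [hj' i hi]) (by simp)]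
      · push Not at hx
        simp [hx]
    have hg : Measurable fun x => ∑ j, (B j).indicator (fun _ => (t j : ℝ≥0∞)) x :=
      Finset.measurable_sum _ fun j _ => measurable_const.indicator (hB j)
    have h1 := h _ hg
    simp_rw [hsum] at h1
    have hmj : ∀ j, Measurable fun x => 1 - expNeg ((B j).indicator (fun _ => (t j : ℝ≥0∞)) x) :=
      fun j => measurable_const.sub (measurable_expNeg.comp (measurable_const.indicator (hB j)))
    rw [lintegral_finsetSum _ fun j _ => hmj j, expNeg_sum] at h1
    simp_rw [lintegral_one_sub_expNeg_indicator (hB _)] at h1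
    simp_rw [hone _ (hB _)]
    rw [← h1]
    refine lintegral_congr fun m => ?_
    rw [lintegral_finsetSum _ fun j _ => measurable_const.indicator (hB j), expNeg_sum]
    refine Finset.prod_congr rfl fun j _ => ?_
    rw [lintegral_indicator_const (hB j), expNeg_natCast_mul]

end

/-! ### Exponential tilting of the Poisson law. -/

section

variable {V : Type*} [MetricSpace V] [MeasurableSpace V]

/-- Exponential tilting of a Poisson random measure tilts its intensity. -/
lemma IsPoissonLaw.withDensity_expNeg {ν : Measure V} [SigmaFinite ν] {Q : Measure (BFMeasure V)}
    (h : IsPoissonLaw ν Q) {g : V → ℝ≥0∞} (hg : Measurable g)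
    (hZ : ∫⁻ m, expNeg (∫⁻ x, g x ∂m.1) ∂Q ≠ 0) :
    IsPoissonLaw (ν.withDensity fun x => expNeg (g x))
      (Q.withDensity fun m => (∫⁻ m, expNeg (∫⁻ x, g x ∂m.1) ∂Q)⁻¹
        * expNeg (∫⁻ x, g x ∂m.1)) := by
  have hQ := h.isProbabilityMeasure
  have hg' := measurable_expNeg_lintegral (V := V) hg
  have hlap : ∀ u : V → ℝ≥0∞, Measurable u →
      ∫⁻ m, expNeg (∫⁻ x, u x ∂m.1) ∂(Q.withDensity fun m =>
        (∫⁻ m, expNeg (∫⁻ x, g x ∂m.1) ∂Q)⁻¹ * expNeg (∫⁻ x, g x ∂m.1))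
      = expNeg (∫⁻ x, (1 - expNeg (u x)) ∂(ν.withDensity fun x => expNeg (g x))) := by
    intro u hu
    have hu' := measurable_expNeg_lintegral (V := V) hu
    have hge : Measurable fun x => expNeg (g x) := measurable_expNeg.comp hg
    have hue : Measurable fun x => 1 - expNeg (u x) :=
      measurable_const.sub (measurable_expNeg.comp hu)
    rw [lintegral_withDensity_eq_lintegral_mul _ (hg'.const_mul _) hu',
      lintegral_withDensity_eq_lintegral_mul _ hge hue]
    simp only [Pi.mul_apply, mul_assoc]
    have hgu : Measurable fun m : BFMeasure V =>
        expNeg (∫⁻ x, g x ∂m.1) * expNeg (∫⁻ x, u x ∂m.1) := hg'.mul hu'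
    rw [lintegral_const_mul _ hgu]
    have h1 : ∫⁻ m : BFMeasure V, expNeg (∫⁻ x, g x ∂m.1) * expNeg (∫⁻ x, u x ∂m.1) ∂Q
        = ∫⁻ m : BFMeasure V, expNeg (∫⁻ x, (g x + u x) ∂m.1) ∂Q := by
      refine lintegral_congr fun m => ?_
      rw [lintegral_add_left hg, expNeg_add]
    -- The first term of this splitting produces the normaliser, and the second is the exponent of
    -- the Laplace functional for the tilted intensity.
    have h2 : ∀ x, 1 - expNeg (g x + u x)
        = (1 - expNeg (g x)) + expNeg (g x) * (1 - expNeg (u x)) := by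
      intro x
      rw [expNeg_add, ENNReal.mul_sub fun _ _ => expNeg_ne_top _, mul_one,
        tsub_add_tsub_cancel (expNeg_le_one _) (mul_le_of_le_one_right' (expNeg_le_one _))]
    rw [h1, h.lintegral_expNeg (g := fun x => g x + u x) (hg.add hu)]
    simp_rw [h2]
    rw [lintegral_add_left (f := fun x => 1 - expNeg (g x)) (measurable_const.sub hge), expNeg_add,
      ← h.lintegral_expNeg hg, ← mul_assoc, ENNReal.inv_mul_cancel hZ, one_mul]
    exact ne_top_of_le_ne_top ENNReal.one_ne_top
      ((lintegral_mono fun m => expNeg_le_one _).trans (by simp))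
  have : IsProbabilityMeasure (Q.withDensity fun m : BFMeasure V =>
      (∫⁻ m, expNeg (∫⁻ x, g x ∂m.1) ∂Q)⁻¹ * expNeg (∫⁻ x, g x ∂m.1)) := by
    refine ⟨?_⟩
    -- The Laplace functional at `u = 0` is the total mass.
    have := hlap 0 measurable_zero
    simpa using this
  exact isPoissonLaw_of_lintegral_expNeg hlap

variable {n : ℕ}

/-- The random variable `e^{-m(Ω_n)}`, as a function of `y` and `m`. -/
def damping (β : ℝ) (f : Fin n → V → ℝ≥0) (y : Fin n → ℝ) (m : BFMeasure V) : ℝ≥0∞ :=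
  expNeg (∑ i, ENNReal.ofReal (y i ^ 2 / 2 + β ^ 2 / 2) * lin (f i) m)

lemma damping_le_one (β : ℝ) (f : Fin n → V → ℝ≥0) (y : Fin n → ℝ) (m : BFMeasure V) :
    damping β f y m ≤ 1 := expNeg_le_one _

lemma measurable_damping (β : ℝ) {f : Fin n → V → ℝ≥0} (hf : ∀ i, Measurable (f i)) :
    Measurable (Function.uncurry (damping β f)) := by
  refine measurable_expNeg.comp (Finset.measurable_sum _ fun i _ => ?_)
  refine Measurable.mul ?_ ((measurable_lin (hf i)).comp measurable_snd)
  exact ENNReal.measurable_ofReal.comp (by fun_prop)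

lemma measurable_damping_right (β : ℝ) {f : Fin n → V → ℝ≥0} (hf : ∀ i, Measurable (f i))
    (y : Fin n → ℝ) : Measurable (damping β f y) :=
  (measurable_damping β hf).of_uncurry_left

lemma damping_of_lt_top {β : ℝ} {f : Fin n → V → ℝ≥0} {m : BFMeasure V}
    (hm : ∀ i, lin (f i) m < ∞) (y : Fin n → ℝ) :
    damping β f y m = ENNReal.ofReal
      (∏ i, Real.exp (-((y i ^ 2 / 2 + β ^ 2 / 2) * (lin (f i) m).toReal))) := by
  rw [damping, expNeg_sum, ENNReal.ofReal_prod_of_nonneg fun i _ => (Real.exp_pos _).le]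
  refine Finset.prod_congr rfl fun i _ => ?_
  rw [expNeg_of_ne_top (ENNReal.mul_ne_top ENNReal.ofReal_ne_top (hm i).ne), ENNReal.toReal_mul,
    ENNReal.toReal_ofReal (by positivity)]

lemma Omega_nonneg {V : Type*} (β : ℝ) (f : Fin n → V → ℝ≥0) (y : Fin n → ℝ) (x : V) :
    0 ≤ Omega β f y x :=
  Finset.sum_nonneg fun i _ => mul_nonneg (by positivity) (f i x).coe_nonneg

lemma measurable_Omega {V : Type*} [MeasurableSpace V] (β : ℝ) {f : Fin n → V → ℝ≥0} (hf : ∀ i, Measurable (f i))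
    (y : Fin n → ℝ) : Measurable (Omega β f y) :=
  Finset.measurable_sum _ fun i _ => (hf i).coe_nnreal_real.const_mul _

lemma damping_eq_expNeg_lintegral (β : ℝ) {f : Fin n → V → ℝ≥0} (hf : ∀ i, Measurable (f i))
    (y : Fin n → ℝ) (m : BFMeasure V) :
    damping β f y m = expNeg (∫⁻ x, ENNReal.ofReal (Omega β f y x) ∂m.1) := by
  have h1 : ∀ x, ENNReal.ofReal (Omega β f y x)
      = ∑ i, ENNReal.ofReal (y i ^ 2 / 2 + β ^ 2 / 2) * (f i x : ℝ≥0∞) := by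
    intro x
    rw [Omega, ENNReal.ofReal_sum_of_nonneg fun i _ =>
      mul_nonneg (by positivity) (f i x).coe_nonneg]
    refine Finset.sum_congr rfl fun i _ => ?_
    rw [ENNReal.ofReal_mul (by positivity), ENNReal.ofReal_coe_nnreal]
  simp_rw [h1]
  rw [lintegral_finsetSum _ fun i _ => (hf i).coe_nnreal_ennreal.const_mul _, damping]
  simp_rw [lintegral_const_mul _ (hf _).coe_nnreal_ennreal]
  rfl

lemma tilt_Omega {V : Type*} [MeasurableSpace V] (β : ℝ) (f : Fin n → V → ℝ≥0) (y : Fin n → ℝ) (ν : Measure V) :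
    tilt ν (Omega β f y)
      = ν.withDensity fun x => expNeg (ENNReal.ofReal (Omega β f y x)) := by
  simp_rw [tilt, expNeg_ofReal (Omega_nonneg β f y _)]

/-- The normalising constant `E[e^{-N(Ω_n)}]`. -/
def normalizer (Q : Measure (BFMeasure V)) (β : ℝ) (f : Fin n → V → ℝ≥0) (y : Fin n → ℝ) : ℝ≥0∞ :=
  ∫⁻ m, damping β f y m ∂Q

lemma measurable_normalizer (Q : Measure (BFMeasure V)) [SFinite Q] (β : ℝ)
    {f : Fin n → V → ℝ≥0} (hf : ∀ i, Measurable (f i)) : Measurable (normalizer Q β f) :=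
  (measurable_damping β hf).lintegral_prod_right'

lemma normalizer_ne_top (Q : Measure (BFMeasure V)) [IsProbabilityMeasure Q] (β : ℝ)
    (f : Fin n → V → ℝ≥0) (y : Fin n → ℝ) : normalizer Q β f y ≠ ∞ :=
  ne_top_of_le_ne_top ENNReal.one_ne_top
    ((lintegral_mono fun m => damping_le_one β f y m).trans (by simp))

/-- Since every `m(f_i)` is almost surely finite, `e^{-m(Ω_n)}` is almost surely positive. -/
lemma normalizer_ne_zero {Q : Measure (BFMeasure V)} [IsProbabilityMeasure Q] (β : ℝ)
    {f : Fin n → V → ℝ≥0} (hf : ∀ i, Measurable (f i))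
    (hQ : ∀ i, ∀ᵐ m ∂Q, lin (f i) m < ∞) (y : Fin n → ℝ) : normalizer Q β f y ≠ 0 := by
  intro h0
  rw [normalizer, lintegral_eq_zero_iff (measurable_damping_right β hf y)]
    at h0
  have : ∀ᵐ m ∂Q, False := by
    filter_upwards [h0, ae_all_iff.2 hQ] with m hm hm'
    have h1 : damping β f y m = 0 := hm
    rw [damping, expNeg_eq_zero, ENNReal.sum_eq_top] at h1
    obtain ⟨i, -, hi⟩ := h1
    exact ENNReal.mul_ne_top ENNReal.ofReal_ne_top (hm' i).ne hi
  exact IsProbabilityMeasure.ne_zero Q (by simpa using this)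

/-- The Laplace functional gives this with a lower integral in the exponent. `Lam` is a Bochner
integral, with default value `0` for a non-integrable function; positivity of the normaliser shows
that the lower integral is finite, so the two agree. -/
lemma normalizer_eq_exp_neg_Lam {ν : Measure V} [SigmaFinite ν] {Q : Measure (BFMeasure V)}
    (h : IsPoissonLaw ν Q) (β : ℝ) {f : Fin n → V → ℝ≥0} (hf : ∀ i, Measurable (f i))
    (hQ : ∀ i, ∀ᵐ m ∂Q, lin (f i) m < ∞) (y : Fin n → ℝ) :
    normalizer Q β f y = ENNReal.ofReal (Real.exp (-Lam ν (Omega β f y))) := by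
  have := h.isProbabilityMeasure
  have h0 := normalizer_ne_zero β hf hQ y
  have h1 : normalizer Q β f y
      = expNeg (∫⁻ x, (1 - expNeg (ENNReal.ofReal (Omega β f y x))) ∂ν) := by
    rw [← h.lintegral_expNeg (measurable_Omega β hf y).ennreal_ofReal]
    exact lintegral_congr fun m => damping_eq_expNeg_lintegral β hf y m
  rw [h1, Ne, expNeg_eq_zero] at h0
  have hm : Measurable fun x => 1 - Real.exp (-Omega β f y x) :=
    measurable_const.sub (measurable_Omega β hf y).neg.exp
  rw [h1, expNeg_of_ne_top h0, Lam, integral_eq_lintegral_of_nonneg_ae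
    (Eventually.of_forall fun x => by simpa using Omega_nonneg β f y x)
    hm.aestronglyMeasurable]
  congr 5
  ext x
  rw [expNeg_ofReal (Omega_nonneg β f y x), ENNReal.ofReal_sub _ (Real.exp_pos _).le,
    ENNReal.ofReal_one]

/-- The law of the random measure, tilted by `e^{-m(Ω_n)}` and normalised, as a function of
`y`. -/
def tiltedKernel (Q : Measure (BFMeasure V)) [SFinite Q] (β : ℝ) (f : Fin n → V → ℝ≥0) :
    Kernel (Fin n → ℝ) (BFMeasure V) :=
  (Kernel.const _ Q).withDensity fun y m => (normalizer Q β f y)⁻¹ * damping β f y m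

lemma tiltedKernel_apply (Q : Measure (BFMeasure V)) [SFinite Q] (β : ℝ)
    {f : Fin n → V → ℝ≥0} (hf : ∀ i, Measurable (f i)) (y : Fin n → ℝ) :
    tiltedKernel Q β f y
      = Q.withDensity fun m => (normalizer Q β f y)⁻¹ * damping β f y m := by
  rw [tiltedKernel, Kernel.withDensity_apply, Kernel.const_apply]
  exact ((measurable_normalizer Q β hf).comp measurable_fst).inv.mul (measurable_damping β hf)

lemma isPoissonLaw_tiltedKernel {ν : Measure V} [SigmaFinite ν] {Q : Measure (BFMeasure V)}
    [IsProbabilityMeasure Q] (h : IsPoissonLaw ν Q) (β : ℝ) {f : Fin n → V → ℝ≥0}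
    (hf : ∀ i, Measurable (f i)) (hQ : ∀ i, ∀ᵐ m ∂Q, lin (f i) m < ∞) (y : Fin n → ℝ) :
    IsPoissonLaw (tilt ν (Omega β f y)) (tiltedKernel Q β f y) := by
  have h0 := normalizer_ne_zero β hf hQ y
  simp_rw [normalizer, damping_eq_expNeg_lintegral β hf] at h0
  rw [tiltedKernel_apply Q β hf, tilt_Omega]
  simp_rw [normalizer, damping_eq_expNeg_lintegral β hf]
  exact h.withDensity_expNeg (measurable_Omega β hf y).ennreal_ofReal h0

lemma isMarkovKernel_tiltedKernel {ν : Measure V} [SigmaFinite ν] {Q : Measure (BFMeasure V)}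
    [IsProbabilityMeasure Q] (h : IsPoissonLaw ν Q) (β : ℝ) {f : Fin n → V → ℝ≥0}
    (hf : ∀ i, Measurable (f i)) (hQ : ∀ i, ∀ᵐ m ∂Q, lin (f i) m < ∞) :
    IsMarkovKernel (tiltedKernel Q β f) :=
  ⟨fun y => (isPoissonLaw_tiltedKernel h β hf hQ y).isProbabilityMeasure⟩

lemma tiltedKernel_real_mul_exp {ν : Measure V} [SigmaFinite ν] {Q : Measure (BFMeasure V)}
    [IsProbabilityMeasure Q] (h : IsPoissonLaw ν Q) (β : ℝ) {f : Fin n → V → ℝ≥0}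
    (hf : ∀ i, Measurable (f i)) (hQ : ∀ i, ∀ᵐ m ∂Q, lin (f i) m < ∞) (y : Fin n → ℝ)
    {B : Set (BFMeasure V)} (hB : MeasurableSet B) :
    (tiltedKernel Q β f y).real B * Real.exp (-Lam ν (Omega β f y))
      = (∫⁻ m in B, damping β f y m ∂Q).toReal := by
  have h1 : Real.exp (-Lam ν (Omega β f y)) = (normalizer Q β f y).toReal := by
    rw [normalizer_eq_exp_neg_Lam h β hf hQ, ENNReal.toReal_ofReal (Real.exp_pos _).le]
  rw [h1, measureReal_def, ← ENNReal.toReal_mul, tiltedKernel_apply Q β hf,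
    withDensity_apply _ hB,
    lintegral_const_mul _ (measurable_damping_right β hf y), mul_comm,
    ← mul_assoc, ENNReal.mul_inv_cancel (normalizer_ne_zero β hf hQ y)
      (normalizer_ne_top Q β f y), one_mul]

/-- The part of the augmented likelihood that does not depend on the random measure. -/
def prefactor (μ Δ β : ℝ) (x y : Fin n → ℝ) : ℝ :=
  ∏ i, (Real.pi⁻¹ * Real.exp ((x i - μ * Δ) * β) * Real.cos (y i * |x i - μ * Δ|))

lemma weight_eq {V : Type*} [MeasurableSpace V] (ν : Measure V) (μ Δ β : ℝ) (f : Fin n → V → ℝ≥0) (x y : Fin n → ℝ) :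
    weight ν μ Δ β f x y = prefactor μ Δ β x y * Real.exp (-Lam ν (Omega β f y)) := by
  rw [weight, prefactor, Finset.prod_mul_distrib, Finset.prod_mul_distrib, ← Real.exp_sum,
    ← Finset.sum_mul, neg_sub, sub_eq_add_neg, Real.exp_add]
  simp
  ring

lemma augmented_eq (μ Δ β : ℝ) (f : Fin n → V → ℝ≥0) (x y : Fin n → ℝ) (m : BFMeasure V) :
    augmented μ Δ β f x y m = prefactor μ Δ β x y
      * ∏ i, Real.exp (-((y i ^ 2 / 2 + β ^ 2 / 2) * (lin (f i) m).toReal)) := by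
  rw [augmented, prefactor, ← Finset.prod_mul_distrib]

/-- For fixed `y`, the augmented likelihood depends on `m` only through `e^{-m(Ω_n)}`. Integrating
that factor over `B` gives the tilted law times its normaliser `e^{-Λ(Ω_n)}`, which `weight`
contains. -/
lemma setIntegral_augmented {ν : Measure V} [SigmaFinite ν] {Q : Measure (BFMeasure V)}
    [IsProbabilityMeasure Q] (h : IsPoissonLaw ν Q) (μ Δ β : ℝ) {f : Fin n → V → ℝ≥0}
    (hf : ∀ i, Measurable (f i)) (hQ : ∀ i, ∀ᵐ m ∂Q, lin (f i) m < ∞) (x y : Fin n → ℝ)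
    {B : Set (BFMeasure V)} (hB : MeasurableSet B) :
    ∫ m in B, augmented μ Δ β f x y m ∂Q
      = (tiltedKernel Q β f y).real B * weight ν μ Δ β f x y := by
  have h1 : ∫ m in B, augmented μ Δ β f x y m ∂Q
      = ∫ m in B, prefactor μ Δ β x y * (damping β f y m).toReal ∂Q := by
    refine integral_congr_ae (ae_restrict_of_ae ?_)
    filter_upwards [ae_all_iff.2 hQ] with m hm
    rw [augmented_eq, damping_of_lt_top hm,
      ENNReal.toReal_ofReal (Finset.prod_nonneg fun i _ => (Real.exp_pos _).le)]
  rw [h1, integral_const_mul, integral_toReal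
    (measurable_damping_right β hf y).aemeasurable
    (Eventually.of_forall fun m => (damping_le_one β f y m).trans_lt ENNReal.one_lt_top),
    ← tiltedKernel_real_mul_exp h β hf hQ y hB, weight_eq]
  ring

end

/-! ### Gaussian cosine integrals in one variable. -/

lemma integrable_cos_mul_exp_neg_sq (a : ℝ) {τ : ℝ} (hτ : 0 < τ) :
    Integrable fun y : ℝ => Real.cos (y * a) * Real.exp (-(y ^ 2 / 2 * τ)) := by
  have h1 : Integrable fun y : ℝ => Real.exp (-(τ / 2) * y ^ 2) :=
    integrable_exp_neg_mul_sq (half_pos hτ)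
  refine h1.mono' (by fun_prop) (Eventually.of_forall fun y => ?_)
  rw [norm_mul, Real.norm_eq_abs, Real.norm_eq_abs, abs_of_pos (Real.exp_pos _),
    show -(τ / 2) * y ^ 2 = -(y ^ 2 / 2 * τ) by ring]
  exact mul_le_of_le_one_left (Real.exp_pos _).le (Real.abs_cos_le_one _)

/-- This is the real part of the Fourier transform of a centred Gaussian. -/
lemma integral_cos_mul_exp_neg_sq (a : ℝ) {τ : ℝ} (hτ : 0 < τ) :
    ∫ y : ℝ, Real.cos (y * a) * Real.exp (-(y ^ 2 / 2 * τ))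
      = √(2 * Real.pi / τ) * Real.exp (-(a ^ 2 / (2 * τ))) := by
  have hb : 0 < ((τ / 2 : ℝ) : ℂ).re := by simpa using hτ
  have h := fourierIntegral_gaussian hb (a : ℂ)
  have h1 : ∀ y : ℝ, Complex.exp (Complex.I * a * y) * Complex.exp (-((τ / 2 : ℝ) : ℂ) * y ^ 2)
      = Complex.exp ((y * a : ℝ) * Complex.I) * ((Real.exp (-(y ^ 2 / 2 * τ)) : ℝ) : ℂ) := by
    intro y
    push_cast
    congr 2 <;> ring
  have h2 : (Real.pi / ((τ / 2 : ℝ) : ℂ)) ^ (1 / 2 : ℂ)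
      * Complex.exp (-(a : ℂ) ^ 2 / (4 * ((τ / 2 : ℝ) : ℂ)))
      = ((√(2 * Real.pi / τ) * Real.exp (-(a ^ 2 / (2 * τ))) : ℝ) : ℂ) := by
    rw [Real.sqrt_eq_rpow, Complex.ofReal_mul, Complex.ofReal_cpow (by positivity)]
    push_cast
    congr 2
    · field_simp
    · field_simp
      ring
  simp_rw [h1] at h
  rw [h2] at h
  have hint : Integrable fun y : ℝ =>
      Complex.exp ((y * a : ℝ) * Complex.I) * ((Real.exp (-(y ^ 2 / 2 * τ)) : ℝ) : ℂ) := by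
    have h3 : Integrable fun y : ℝ => Real.exp (-(τ / 2) * y ^ 2) :=
      integrable_exp_neg_mul_sq (half_pos hτ)
    refine h3.mono' (by fun_prop) (Eventually.of_forall fun y => ?_)
    rw [norm_mul, Complex.norm_exp_ofReal_mul_I, one_mul, Complex.norm_real, Real.norm_eq_abs,
      abs_of_pos (Real.exp_pos _), show -(τ / 2) * y ^ 2 = -(y ^ 2 / 2 * τ) by ring]
  have h4 := congrArg Complex.re h
  rw [Complex.ofReal_re, ← RCLike.re_eq_complex_re, ← integral_re hint] at h4
  rw [← h4]
  refine integral_congr_ae (Eventually.of_forall fun y => ?_)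
  simp only [RCLike.re_eq_complex_re, Complex.re_mul_ofReal, Complex.exp_ofReal_mul_I_re]

lemma setIntegral_Ici_cos_mul_exp_neg_sq (a : ℝ) {τ : ℝ} (hτ : 0 < τ) :
    ∫ y in Set.Ici (0 : ℝ), Real.cos (y * a) * Real.exp (-(y ^ 2 / 2 * τ))
      = √(2 * Real.pi / τ) * Real.exp (-(a ^ 2 / (2 * τ))) / 2 := by
  have h := integral_comp_abs (f := fun y => Real.cos (y * a) * Real.exp (-(y ^ 2 / 2 * τ)))
  have h1 : ∀ y : ℝ, Real.cos (|y| * a) = Real.cos (y * a) := fun y => by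
    rcases abs_cases y with ⟨h, -⟩ | ⟨h, -⟩ <;> rw [h]
    rw [neg_mul, Real.cos_neg]
  simp only [sq_abs, h1] at h
  rw [integral_cos_mul_exp_neg_sq a hτ] at h
  rw [integral_Ici_eq_integral_Ioi]
  linarith

/-- Oscillation makes the truncated Gaussian cosine integrals bounded uniformly in the variance. -/
lemma abs_setIntegral_Icc_cos_mul_exp_neg_sq_le {a τ R : ℝ} (ha : 0 < a) (hτ : 0 ≤ τ)
    (hR : 0 ≤ R) :
    |∫ y in Set.Icc 0 R, Real.cos (y * a) * Real.exp (-(y ^ 2 / 2 * τ))| ≤ a⁻¹ := by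
  rw [integral_Icc_eq_integral_Ioc, ← intervalIntegral.integral_of_le hR]
  have hg : ∀ y : ℝ, HasDerivAt (fun y : ℝ => Real.exp (-(y ^ 2 / 2 * τ)))
      (Real.exp (-(y ^ 2 / 2 * τ)) * (-(y * τ))) y := by
    intro y
    have h1 : HasDerivAt (fun y : ℝ => -(y ^ 2 / 2 * τ)) (-(y * τ)) y := by
      have := ((((hasDerivAt_id y).pow 2).div_const 2).mul_const τ).neg
      convert! this using 1
      simp
    exact h1.exp
  have hs : ∀ y : ℝ, HasDerivAt (fun y : ℝ => Real.sin (y * a) / a) (Real.cos (y * a)) y := by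
    intro y
    have := (((hasDerivAt_id y).mul_const a).sin).div_const a
    convert! this using 1
    simp [ha.ne']
  -- Integration by parts, with `sin(ya)/a` as the primitive of the cosine.
  have h1 : ∫ y in (0 : ℝ)..R, (Real.cos (y * a) * Real.exp (-(y ^ 2 / 2 * τ))
      + Real.sin (y * a) / a * (Real.exp (-(y ^ 2 / 2 * τ)) * (-(y * τ))))
      = Real.sin (R * a) / a * Real.exp (-(R ^ 2 / 2 * τ)) := by
    rw [intervalIntegral.integral_eq_sub_of_hasDerivAt (fun y _ => (hs y).mul (hg y))
      (Continuous.intervalIntegrable (by fun_prop) _ _)]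
    simp
  have h2 : ∫ y in (0 : ℝ)..R, Real.exp (-(y ^ 2 / 2 * τ)) * (-(y * τ))
      = Real.exp (-(R ^ 2 / 2 * τ)) - 1 := by
    rw [intervalIntegral.integral_eq_sub_of_hasDerivAt (fun y _ => hg y)
      (Continuous.intervalIntegrable (by fun_prop) _ _)]
    simp
  rw [intervalIntegral.integral_add (Continuous.intervalIntegrable (by fun_prop) _ _)
    (Continuous.intervalIntegrable (by fun_prop) _ _)] at h1
  have h3 : |∫ y in (0 : ℝ)..R, Real.sin (y * a) / a
      * (Real.exp (-(y ^ 2 / 2 * τ)) * (-(y * τ)))| ≤ a⁻¹ * (1 - Real.exp (-(R ^ 2 / 2 * τ))) := by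
    -- The Gaussian factor decreases on `[0, R]`, so the integral of the modulus of its derivative
    -- is its total drop `1 - e^{-R²τ/2}`. Together with the boundary term, at most `a⁻¹
    -- e^{-R²τ/2}`, this gives `a⁻¹` whatever `τ` and `R` are.
    have h4 : a⁻¹ * (1 - Real.exp (-(R ^ 2 / 2 * τ)))
        = ∫ y in (0 : ℝ)..R, -a⁻¹ * (Real.exp (-(y ^ 2 / 2 * τ)) * (-(y * τ))) := by
      rw [intervalIntegral.integral_const_mul, h2]
      ring
    rw [h4, ← Real.norm_eq_abs]
    refine intervalIntegral.norm_integral_le_of_norm_le hR (ae_of_all _ fun y hy => ?_)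
      (Continuous.intervalIntegrable (by fun_prop) _ _)
    rw [norm_mul, norm_div, norm_mul, norm_neg, Real.norm_eq_abs, Real.norm_eq_abs,
      Real.norm_eq_abs, Real.norm_eq_abs, abs_of_pos ha, abs_of_pos (Real.exp_pos _),
      abs_of_nonneg (mul_nonneg hy.1.le hτ)]
    have h5 : |Real.sin (y * a)| / a ≤ a⁻¹ := by
      rw [div_eq_mul_inv]
      exact mul_le_of_le_one_left (inv_pos.2 ha).le (Real.abs_sin_le_one _)
    calc _ ≤ a⁻¹ * (Real.exp (-(y ^ 2 / 2 * τ)) * (y * τ)) :=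
          mul_le_mul_of_nonneg_right h5
            (mul_nonneg (Real.exp_pos _).le (mul_nonneg hy.1.le hτ))
      _ = _ := by ring
  have h6 : |Real.sin (R * a) / a * Real.exp (-(R ^ 2 / 2 * τ))|
      ≤ a⁻¹ * Real.exp (-(R ^ 2 / 2 * τ)) := by
    rw [abs_mul, abs_div, abs_of_pos ha, abs_of_pos (Real.exp_pos _), div_eq_mul_inv]
    exact mul_le_mul_of_nonneg_right
      (mul_le_of_le_one_left (inv_pos.2 ha).le (Real.abs_sin_le_one _)) (Real.exp_pos _).le
  rw [eq_sub_of_add_eq h1]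
  refine (abs_sub _ _).trans ?_
  linarith

/-- One factor of the augmented likelihood, with `A = x - μ Δ` and `τ = m(f)`. -/
def augmentedFactor (β A τ y : ℝ) : ℝ :=
  Real.pi⁻¹ * Real.exp (A * β) * Real.cos (y * |A|) * Real.exp (-((y ^ 2 / 2 + β ^ 2 / 2) * τ))

lemma augmentedFactor_eq (β A τ y : ℝ) :
    augmentedFactor β A τ y = Real.pi⁻¹ * Real.exp (A * β) * Real.exp (-(β ^ 2 / 2 * τ))
      * (Real.cos (y * |A|) * Real.exp (-(y ^ 2 / 2 * τ))) := by
  rw [augmentedFactor, add_mul, neg_add, Real.exp_add]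
  ring

lemma integrable_augmentedFactor (β A : ℝ) {τ : ℝ} (hτ : 0 < τ) :
    Integrable (augmentedFactor β A τ) :=
  ((integrable_cos_mul_exp_neg_sq |A| hτ).const_mul _).congr
    (Eventually.of_forall fun y => (augmentedFactor_eq β A τ y).symm)

/-- Expanding the square, with `A = x - c`: `-(A - βv)²/(2v) = Aβ - β²v/2 - A²/(2v)`. The last term
comes from the cosine integral and the others from the prefactors. -/
lemma setIntegral_Ici_augmentedFactor (β c x : ℝ) {v : ℝ≥0} (hv : 0 < v) :
    ∫ y in Set.Ici (0 : ℝ), augmentedFactor β (x - c) v y = gaussianPDFReal (c + β * v) v x := by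
  have hv' : (0 : ℝ) < v := hv
  simp_rw [augmentedFactor_eq]
  rw [integral_const_mul, setIntegral_Ici_cos_mul_exp_neg_sq _ hv', gaussianPDFReal, sq_abs]
  have h1 : Real.exp (-(x - (c + β * v)) ^ 2 / (2 * v))
      = Real.exp ((x - c) * β) * Real.exp (-(β ^ 2 / 2 * v))
        * Real.exp (-((x - c) ^ 2 / (2 * v))) := by
    rw [← Real.exp_add, ← Real.exp_add]
    congr 1
    field_simp
    ring
  have h2 : (√(2 * Real.pi * v))⁻¹ = Real.pi⁻¹ * √(2 * Real.pi / v) / 2 := by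
    have h3 : √(2 * Real.pi / v) = 2 * Real.pi / √(2 * Real.pi * v) := by
      rw [eq_div_iff (by positivity), ← Real.sqrt_mul (by positivity)]
      rw [show 2 * Real.pi / v * (2 * Real.pi * v) = (2 * Real.pi) ^ 2 by field_simp]
      exact Real.sqrt_sq (by positivity)
    rw [h3]
    field_simp
  rw [h1, h2]
  ring

lemma abs_setIntegral_Icc_augmentedFactor_le (β : ℝ) {A τ R : ℝ} (hA : A ≠ 0) (hτ : 0 ≤ τ)
    (hR : 0 ≤ R) :
    |∫ y in Set.Icc 0 R, augmentedFactor β A τ y|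
      ≤ Real.pi⁻¹ * Real.exp (A * β) * |A|⁻¹ := by
  simp_rw [augmentedFactor_eq]
  rw [integral_const_mul, abs_mul]
  refine mul_le_mul ?_ (abs_setIntegral_Icc_cos_mul_exp_neg_sq_le (abs_pos.2 hA) hτ hR)
    (abs_nonneg _) (by positivity)
  rw [abs_of_pos (by positivity)]
  refine mul_le_of_le_one_right (by positivity) ?_
  rw [Real.exp_le_one_iff, neg_nonpos]
  positivity

lemma tendsto_setIntegral_Icc_augmentedFactor (β A : ℝ) {τ : ℝ} (hτ : 0 < τ) :
    Tendsto (fun R : ℝ => ∫ y in Set.Icc 0 R, augmentedFactor β A τ y) atTop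
      (𝓝 (∫ y in Set.Ici (0 : ℝ), augmentedFactor β A τ y)) := by
  rw [integral_Ici_eq_integral_Ioi]
  refine (intervalIntegral_tendsto_integral_Ioi 0
    (integrable_augmentedFactor β A hτ).integrableOn tendsto_id).congr' ?_
  filter_upwards [eventually_ge_atTop 0] with R hR
  rw [integral_Icc_eq_integral_Ioc, ← intervalIntegral.integral_of_le hR]
  rfl

/-! ### Bayes' formula for a dominated sampling kernel. -/

section

variable {𝓧 𝓨 : Type*} [MeasurableSpace 𝓧] [MeasurableSpace 𝓨]

open Classical in
/-- The density of the posterior with respect to the prior `Q`, for a sampling density `c x m`;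
it is set to `1` at those `x` whose likelihood is `0` or `∞`. -/
def posteriorDensity (Q : Measure 𝓨) (c : 𝓧 → 𝓨 → ℝ≥0∞) (x : 𝓧) (m : 𝓨) : ℝ≥0∞ :=
  if ∫⁻ m, c x m ∂Q = 0 ∨ ∫⁻ m, c x m ∂Q = ∞ then 1 else (∫⁻ m, c x m ∂Q)⁻¹ * c x m

/-- The posterior law of a parameter with prior `Q`, given an observation with sampling density
`c x m`. -/
def posteriorKernel (Q : Measure 𝓨) [SFinite Q] (c : 𝓧 → 𝓨 → ℝ≥0∞) : Kernel 𝓧 𝓨 :=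
  (Kernel.const 𝓧 Q).withDensity (posteriorDensity Q c)

lemma measurable_posteriorDensity (Q : Measure 𝓨) [SFinite Q] {c : 𝓧 → 𝓨 → ℝ≥0∞}
    (hc : Measurable (Function.uncurry c)) :
    Measurable (Function.uncurry (posteriorDensity Q c)) := by
  have hL : Measurable fun p : 𝓧 × 𝓨 => ∫⁻ m, c p.1 m ∂Q :=
    hc.lintegral_prod_right'.comp measurable_fst
  refine Measurable.ite ?_ measurable_const (hL.inv.mul hc)
  exact (hL (measurableSet_singleton 0)).union (hL (measurableSet_singleton ∞))

lemma posteriorKernel_apply (Q : Measure 𝓨) [SFinite Q] {c : 𝓧 → 𝓨 → ℝ≥0∞}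
    (hc : Measurable (Function.uncurry c)) (x : 𝓧) :
    posteriorKernel Q c x = Q.withDensity (posteriorDensity Q c x) := by
  rw [posteriorKernel, Kernel.withDensity_apply _ (measurable_posteriorDensity Q hc),
    Kernel.const_apply]

lemma posteriorKernel_apply_of_ne (Q : Measure 𝓨) [SFinite Q] {c : 𝓧 → 𝓨 → ℝ≥0∞}
    (hc : Measurable (Function.uncurry c)) {x : 𝓧} (h0 : ∫⁻ m, c x m ∂Q ≠ 0)
    (h1 : ∫⁻ m, c x m ∂Q ≠ ∞) {B : Set 𝓨} (hB : MeasurableSet B) :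
    posteriorKernel Q c x B = (∫⁻ m, c x m ∂Q)⁻¹ * ∫⁻ m in B, c x m ∂Q := by
  have h : posteriorDensity Q c x = fun m => (∫⁻ m, c x m ∂Q)⁻¹ * c x m := by
    ext m
    rw [posteriorDensity, if_neg (by tauto)]
  rw [posteriorKernel_apply Q hc, withDensity_apply _ hB, h,
    lintegral_const_mul _ hc.of_uncurry_left]

lemma isMarkovKernel_posteriorKernel (Q : Measure 𝓨) [IsProbabilityMeasure Q]
    {c : 𝓧 → 𝓨 → ℝ≥0∞} (hc : Measurable (Function.uncurry c)) :
    IsMarkovKernel (posteriorKernel Q c) := by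
  refine ⟨fun x => ⟨?_⟩⟩
  by_cases h : ∫⁻ m, c x m ∂Q = 0 ∨ ∫⁻ m, c x m ∂Q = ∞
  · have h' : posteriorDensity Q c x = fun _ => 1 := by
      ext m
      rw [posteriorDensity, if_pos h]
    rw [posteriorKernel_apply Q hc, h', withDensity_apply _ MeasurableSet.univ]
    simp
  · push Not at h
    rw [posteriorKernel_apply_of_ne Q hc h.1 h.2 MeasurableSet.univ, Measure.restrict_univ,
      ENNReal.inv_mul_cancel h.1 h.2]

variable {S : Type*} [MeasurableSpace S] {P : Measure S} [IsProbabilityMeasure P]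
  {N : S → 𝓨} {X : S → 𝓧} {s : Kernel 𝓨 𝓧} [IsMarkovKernel s] {ρ : Measure 𝓧} [SigmaFinite ρ]
  {c : 𝓧 → 𝓨 → ℝ≥0∞}

/-- Tonelli: the joint law is disintegrated over `N` by hypothesis, and exchanging the integrals
disintegrates it over the data. -/
lemma map_prodMk_apply_of_density (hc : Measurable (Function.uncurry c))
    (hX : HasCondDistrib X N s P)
    (hs : ∀ᵐ m ∂(P.map N), s m = ρ.withDensity fun x => c x m)
    {A : Set (𝓧 × 𝓨)} (hA : MeasurableSet A) :
    P.map (fun ω => (X ω, N ω)) A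
      = ∫⁻ x, ∫⁻ m in Prod.mk x ⁻¹' A, c x m ∂(P.map N) ∂ρ := by
  have hN := hX.aemeasurable_fst
  have : IsProbabilityMeasure (P.map N) := Measure.isProbabilityMeasure_map hN
  have h1 : P.map (fun ω => (X ω, N ω)) = (P.map fun ω => (N ω, X ω)).map Prod.swap := by
    rw [AEMeasurable.map_map_of_aemeasurable measurable_swap.aemeasurable hX.aemeasurable]
    rfl
  rw [h1, hX.map_eq, Measure.map_apply measurable_swap hA,
    Measure.compProd_apply (measurable_swap hA)]
  have h2 : ∀ x, ∫⁻ m in Prod.mk x ⁻¹' A, c x m ∂(P.map N)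
      = ∫⁻ m, A.indicator (Function.uncurry c) (x, m) ∂(P.map N) := by
    intro x
    rw [← lintegral_indicator (measurable_prodMk_left hA)]
    rfl
  simp_rw [h2]
  rw [lintegral_lintegral_swap (f := fun x m => A.indicator (Function.uncurry c) (x, m))
    (hc.indicator hA).aemeasurable]
  refine lintegral_congr_ae ?_
  filter_upwards [hs] with m hm
  have h3 : MeasurableSet ((fun x => (x, m)) ⁻¹' A) := measurable_prodMk_right hA
  have h4 : Prod.mk m ⁻¹' (Prod.swap ⁻¹' A) = (fun x => (x, m)) ⁻¹' A := rfl
  rw [hm, h4, withDensity_apply _ h3, ← lintegral_indicator h3]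
  rfl

lemma map_eq_withDensity_of_density (hc : Measurable (Function.uncurry c))
    (hX : HasCondDistrib X N s P)
    (hs : ∀ᵐ m ∂(P.map N), s m = ρ.withDensity fun x => c x m) :
    P.map X = ρ.withDensity fun x => ∫⁻ m, c x m ∂(P.map N) := by
  ext E hE
  have h1 : P.map X E = P.map (fun ω => (X ω, N ω)) (E ×ˢ Set.univ) := by
    rw [Measure.map_apply_of_aemeasurable hX.aemeasurable_snd hE,
      Measure.map_apply_of_aemeasurable (hX.aemeasurable_snd.prodMk hX.aemeasurable_fst)
        (hE.prod MeasurableSet.univ)]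
    congr 1
    ext ω
    simp
  rw [h1, map_prodMk_apply_of_density hc hX hs (hE.prod MeasurableSet.univ),
    withDensity_apply _ hE, ← lintegral_indicator hE]
  refine lintegral_congr fun x => ?_
  by_cases hx : x ∈ E <;> simp [hx]

/-- Bayes' formula for a sampling kernel that has a density. -/
lemma hasCondDistrib_posteriorKernel (hc : Measurable (Function.uncurry c))
    (hX : HasCondDistrib X N s P)
    (hs : ∀ᵐ m ∂(P.map N), s m = ρ.withDensity fun x => c x m) :
    HasCondDistrib N X (posteriorKernel (P.map N) c) P := by
  have hN := hX.aemeasurable_fst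
  have : IsProbabilityMeasure (P.map N) := Measure.isProbabilityMeasure_map hN
  have hPX : IsProbabilityMeasure (P.map X) := Measure.isProbabilityMeasure_map hX.aemeasurable_snd
  have := isMarkovKernel_posteriorKernel (P.map N) hc
  refine ⟨hX.aemeasurable_snd.prodMk hN, ?_⟩
  have hmarg := map_eq_withDensity_of_density hc hX hs
  have hL : Measurable fun x => ∫⁻ m, c x m ∂(P.map N) := hc.lintegral_prod_right'
  -- The likelihood is the `ρ`-density of the law of `X`, hence has integral `1`.
  have hfin : ∀ᵐ x ∂ρ, ∫⁻ m, c x m ∂(P.map N) < ∞ := by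
    refine ae_lt_top hL ?_
    have h1 := hPX.measure_univ
    rw [hmarg, withDensity_apply _ MeasurableSet.univ, Measure.restrict_univ] at h1
    rw [h1]
    exact ENNReal.one_ne_top
  ext A hA
  rw [map_prodMk_apply_of_density hc hX hs hA, Measure.compProd_apply hA, hmarg,
    lintegral_withDensity_eq_lintegral_mul _ hL (Kernel.measurable_kernel_prodMk_left hA)]
  refine lintegral_congr_ae ?_
  filter_upwards [hfin] with x hx
  rw [Pi.mul_apply]
  -- Where the likelihood vanishes both sides are zero, so the default value of the posterior is
  -- immaterial.
  by_cases h0 : ∫⁻ m, c x m ∂(P.map N) = 0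
  · rw [h0, zero_mul]
    exact le_antisymm ((setLIntegral_le_lintegral _ _).trans h0.le) bot_le
  · rw [posteriorKernel_apply_of_ne _ hc h0 hx.ne (measurable_prodMk_left hA), ← mul_assoc,
      ENNReal.mul_inv_cancel h0 hx.ne, one_mul]

end

/-! ### The Gaussian sampling density and its augmentation by `y`. -/

lemma pi_gaussianReal_eq_withDensity {n : ℕ} (a : Fin n → ℝ) {v : Fin n → ℝ≥0}
    (hv : ∀ i, v i ≠ 0) :
    Measure.pi (fun i => gaussianReal (a i) (v i))
      = volume.withDensity fun x => ENNReal.ofReal (∏ i, gaussianPDFReal (a i) (v i) (x i)) := by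
  refine Measure.pi_eq fun s hs => ?_
  rw [withDensity_apply _ (MeasurableSet.univ_pi hs), volume_pi, Measure.restrict_pi_pi]
  have hint : ∀ i, Integrable (gaussianPDFReal (a i) (v i)) (volume.restrict (s i)) := fun i =>
    (integrable_gaussianPDFReal _ _).integrableOn
  rw [← ofReal_integral_eq_lintegral_ofReal (Integrable.fintype_prod hint)
    (Eventually.of_forall fun x => Finset.prod_nonneg fun i _ => gaussianPDFReal_nonneg _ _ _),
    integral_fintype_prod_eq_prod, ENNReal.ofReal_prod_of_nonneg
      fun i _ => integral_nonneg fun x => gaussianPDFReal_nonneg _ _ _]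
  exact Finset.prod_congr rfl fun i _ => (gaussianReal_apply_eq_integral _ (hv i) _).symm

/-- Needed for dominated convergence when all sides of a box tend to infinity independently: the
constant vectors `(k, …, k)` are cofinal. -/
lemma isCountablyGenerated_atTop_pi (n : ℕ) :
    (atTop : Filter (Fin n → ℝ)).IsCountablyGenerated := by
  have h : (atTop : Filter (Fin n → ℝ)) = ⨅ k : ℕ, 𝓟 (Set.Ici fun _ => (k : ℝ)) := by
    refine le_antisymm (le_iInf fun k => le_principal_iff.2 (Ici_mem_atTop _)) ?_
    rw [atTop]
    refine le_iInf fun a => ?_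
    obtain ⟨k, hk⟩ := exists_nat_ge (∑ i, |a i|)
    refine iInf_le_of_le k (principal_mono.2 (Set.Ici_subset_Ici.2 fun i => ?_))
    exact (le_abs_self _).trans ((Finset.single_le_sum (f := fun i => |a i|)
      (fun j _ => abs_nonneg _) (Finset.mem_univ i)).trans hk)
  rw [h]
  infer_instance

section

variable {V : Type*} [MetricSpace V] [MeasurableSpace V] {n : ℕ}

lemma measurable_condDensity (μ Δ β : ℝ) {f : Fin n → V → ℝ≥0} (hf : ∀ i, Measurable (f i)) :
    Measurable fun p : (Fin n → ℝ) × BFMeasure V => condDensity μ Δ β f p.1 p.2 := by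
  have hl : ∀ i, Measurable fun p : (Fin n → ℝ) × BFMeasure V => lin (f i) p.2 := fun i =>
    (measurable_lin (hf i)).comp measurable_snd
  have h1 := fun i => (hl i).ennreal_toReal
  have h2 := fun i => (hl i).ennreal_toNNReal
  simp only [condDensity, gaussianPDFReal]
  fun_prop

lemma condDensity_nonneg (μ Δ β : ℝ) (f : Fin n → V → ℝ≥0) (x : Fin n → ℝ) (m : BFMeasure V) :
    0 ≤ condDensity μ Δ β f x m :=
  Finset.prod_nonneg fun _ _ => gaussianPDFReal_nonneg _ _ _

lemma condDensity_pos (μ Δ β : ℝ) {f : Fin n → V → ℝ≥0} (x : Fin n → ℝ) {m : BFMeasure V}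
    (hm : ∀ i, 0 < lin (f i) m ∧ lin (f i) m < ∞) : 0 < condDensity μ Δ β f x m :=
  Finset.prod_pos fun i _ => gaussianPDFReal_pos _ _ _
    (ENNReal.toNNReal_pos (hm i).1.ne' (hm i).2.ne).ne'

lemma sampling_eq_withDensity (μ Δ β : ℝ) {f : Fin n → V → ℝ≥0} (hf : ∀ i, Measurable (f i))
    {m : BFMeasure V} (hm : ∀ i, 0 < lin (f i) m ∧ lin (f i) m < ∞) :
    sampling μ Δ β f hf m
      = volume.withDensity fun x => ENNReal.ofReal (condDensity μ Δ β f x m) :=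
  pi_gaussianReal_eq_withDensity _ fun i =>
    (ENNReal.toNNReal_pos (hm i).1.ne' (hm i).2.ne).ne'

instance (μ Δ β : ℝ) (f : Fin n → V → ℝ≥0) (hf : ∀ i, Measurable (f i)) :
    IsMarkovKernel (sampling μ Δ β f hf) :=
  ⟨fun m => inferInstanceAs (IsProbabilityMeasure (Measure.pi fun i =>
    gaussianReal (μ * Δ + β * (lin (f i) m).toReal) (lin (f i) m).toNNReal))⟩

lemma augmented_eq_prod_augmentedFactor (μ Δ β : ℝ) (f : Fin n → V → ℝ≥0) (x y : Fin n → ℝ)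
    (m : BFMeasure V) :
    augmented μ Δ β f x y m
      = ∏ i, augmentedFactor β (x i - μ * Δ) (lin (f i) m).toReal (y i) := rfl

lemma measurable_augmented (μ Δ β : ℝ) {f : Fin n → V → ℝ≥0} (hf : ∀ i, Measurable (f i))
    (x : Fin n → ℝ) : Measurable (Function.uncurry (augmented μ Δ β f x)) := by
  have h1 : ∀ i, Measurable fun p : (Fin n → ℝ) × BFMeasure V => (lin (f i) p.2).toReal :=
    fun i => ((measurable_lin (hf i)).comp measurable_snd).ennreal_toReal
  simp only [augmented, Function.uncurry_def]
  fun_prop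

lemma setIntegral_pi_augmented (μ Δ β : ℝ) (f : Fin n → V → ℝ≥0) (x : Fin n → ℝ)
    (m : BFMeasure V) (s : Fin n → Set ℝ) :
    ∫ y in Set.pi Set.univ s, augmented μ Δ β f x y m
      = ∏ i, ∫ y in s i, augmentedFactor β (x i - μ * Δ) (lin (f i) m).toReal y := by
  simp_rw [augmented_eq_prod_augmentedFactor]
  rw [volume_pi, Measure.restrict_pi_pi, integral_fintype_prod_eq_prod]

lemma integrableOn_augmented (μ Δ β : ℝ) {f : Fin n → V → ℝ≥0} (x : Fin n → ℝ)
    {m : BFMeasure V} (hm : ∀ i, 0 < lin (f i) m ∧ lin (f i) m < ∞) :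
    IntegrableOn (fun y => augmented μ Δ β f x y m) (Set.Ici 0) := by
  rw [← Set.pi_univ_Ici, IntegrableOn, volume_pi, Measure.restrict_pi_pi]
  exact Integrable.fintype_prod fun i => (integrable_augmentedFactor β _
    (ENNReal.toReal_pos (hm i).1.ne' (hm i).2.ne)).integrableOn

lemma setIntegral_Ici_augmented (μ Δ β : ℝ) {f : Fin n → V → ℝ≥0} (x : Fin n → ℝ)
    {m : BFMeasure V} (hm : ∀ i, 0 < lin (f i) m ∧ lin (f i) m < ∞) :
    ∫ y in Set.Ici 0, augmented μ Δ β f x y m = condDensity μ Δ β f x m := by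
  rw [← Set.pi_univ_Ici, setIntegral_pi_augmented]
  exact Finset.prod_congr rfl fun i _ =>
    setIntegral_Ici_augmentedFactor β (μ * Δ) (x i)
      (ENNReal.toNNReal_pos (hm i).1.ne' (hm i).2.ne)

lemma abs_setIntegral_Icc_augmented_le (μ Δ β : ℝ) (f : Fin n → V → ℝ≥0) {x : Fin n → ℝ}
    (hx : ∀ i, x i ≠ μ * Δ) (m : BFMeasure V) {R : Fin n → ℝ} (hR : 0 ≤ R) :
    |∫ y in Set.Icc 0 R, augmented μ Δ β f x y m|
      ≤ ∏ i, (Real.pi⁻¹ * Real.exp ((x i - μ * Δ) * β) * |x i - μ * Δ|⁻¹) := by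
  rw [← Set.pi_univ_Icc, setIntegral_pi_augmented, Finset.abs_prod]
  exact Finset.prod_le_prod (fun i _ => abs_nonneg _) fun i _ =>
    abs_setIntegral_Icc_augmentedFactor_le β (sub_ne_zero.2 (hx i)) ENNReal.toReal_nonneg (hR i)

lemma tendsto_setIntegral_Icc_augmented (μ Δ β : ℝ) {f : Fin n → V → ℝ≥0} (x : Fin n → ℝ)
    {m : BFMeasure V} (hm : ∀ i, 0 < lin (f i) m ∧ lin (f i) m < ∞) :
    Tendsto (fun R : Fin n → ℝ => ∫ y in Set.Icc 0 R, augmented μ Δ β f x y m) atTop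
      (𝓝 (condDensity μ Δ β f x m)) := by
  rw [← setIntegral_Ici_augmented μ Δ β x hm, ← Set.pi_univ_Ici]
  simp_rw [← Set.pi_univ_Icc, setIntegral_pi_augmented]
  refine tendsto_finsetProd _ fun i _ => ?_
  refine (tendsto_setIntegral_Icc_augmentedFactor β _
    (ENNReal.toReal_pos (hm i).1.ne' (hm i).2.ne)).comp ?_
  refine tendsto_atTop.2 fun b => ?_
  filter_upwards [eventually_ge_atTop fun _ => b] with R hR using hR i

/-- The uniform bound on the box integrals passes to their limit. The density is thus bounded in
`m`, however small the variances `m(f_i)` are. -/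
lemma condDensity_le (μ Δ β : ℝ) {f : Fin n → V → ℝ≥0} {x : Fin n → ℝ}
    (hx : ∀ i, x i ≠ μ * Δ) {m : BFMeasure V} (hm : ∀ i, 0 < lin (f i) m ∧ lin (f i) m < ∞) :
    condDensity μ Δ β f x m
      ≤ ∏ i, (Real.pi⁻¹ * Real.exp ((x i - μ * Δ) * β) * |x i - μ * Δ|⁻¹) := by
  refine le_of_tendsto (tendsto_setIntegral_Icc_augmented μ Δ β x hm) ?_
  filter_upwards [eventually_ge_atTop 0] with R hR
  exact (le_abs_self _).trans (abs_setIntegral_Icc_augmented_le μ Δ β f hx m hR)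

lemma abs_augmented_le (μ Δ β : ℝ) (f : Fin n → V → ℝ≥0) (x y : Fin n → ℝ) (m : BFMeasure V) :
    |augmented μ Δ β f x y m| ≤ (∏ i, (Real.pi⁻¹ * Real.exp ((x i - μ * Δ) * β)))
      * ∏ i, Real.exp (-((y i ^ 2 / 2 + β ^ 2 / 2) * (lin (f i) m).toReal)) := by
  rw [augmented, ← Finset.prod_mul_distrib, Finset.abs_prod]
  refine Finset.prod_le_prod (fun i _ => abs_nonneg _) fun i _ => ?_
  rw [abs_mul, abs_mul, abs_of_pos (Real.exp_pos _),
    abs_of_pos (by positivity : 0 < Real.pi⁻¹ * Real.exp ((x i - μ * Δ) * β))]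
  exact mul_le_mul_of_nonneg_right
    (mul_le_of_le_one_right (by positivity) (Real.abs_cos_le_one _)) (Real.exp_pos _).le

/-- The augmented likelihood is bounded in `(y, m)`; on a box this justifies Fubini without any
condition on `Λ`. -/
lemma integrable_augmented_of_isFiniteMeasure (Q : Measure (BFMeasure V)) [IsFiniteMeasure Q]
    (ρ : Measure (Fin n → ℝ)) [IsFiniteMeasure ρ] (μ Δ β : ℝ) {f : Fin n → V → ℝ≥0}
    (hf : ∀ i, Measurable (f i)) (x : Fin n → ℝ) :
    Integrable (Function.uncurry (augmented μ Δ β f x)) (ρ.prod Q) := by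
  refine Integrable.of_bound (measurable_augmented μ Δ β hf x).aestronglyMeasurable
    (∏ i, (Real.pi⁻¹ * Real.exp ((x i - μ * Δ) * β))) (Eventually.of_forall fun p => ?_)
  refine (abs_augmented_le μ Δ β f x p.1 p.2).trans
    (mul_le_of_le_one_right (Finset.prod_nonneg fun i _ => by positivity) ?_)
  refine Finset.prod_le_one (fun i _ => (Real.exp_pos _).le) fun i _ => ?_
  rw [Real.exp_le_one_iff, neg_nonpos]
  exact mul_nonneg (by positivity) ENNReal.toReal_nonneg

variable {ν : Measure V} [SigmaFinite ν] {Q : Measure (BFMeasure V)} [IsProbabilityMeasure Q]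

/-- Dropping the cosines leaves a constant times `e^{-m(Ω_n)}`, whose integral over `m` is
`e^{-Λ(Ω_n)}`, integrable in `y` by hypothesis. -/
lemma integrable_augmented_Ici (h : IsPoissonLaw ν Q) (μ Δ β : ℝ) {f : Fin n → V → ℝ≥0}
    (hf : ∀ i, Measurable (f i)) (hQ : ∀ i, ∀ᵐ m ∂Q, lin (f i) m < ∞) (x : Fin n → ℝ)
    (hLam : IntegrableOn (fun y : Fin n → ℝ => Real.exp (-Lam ν (Omega β f y))) (Set.Ici 0)) :
    Integrable (Function.uncurry (augmented μ Δ β f x))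
      ((volume.restrict (Set.Ici 0)).prod Q) := by
  have hmeas : Measurable fun p : (Fin n → ℝ) × BFMeasure V => (damping β f p.1 p.2).toReal :=
    (measurable_damping β hf).ennreal_toReal
  have hdamp : Integrable (fun p : (Fin n → ℝ) × BFMeasure V => (damping β f p.1 p.2).toReal)
      ((volume.restrict (Set.Ici 0)).prod Q) := by
    rw [integrable_prod_iff hmeas.aestronglyMeasurable]
    refine ⟨Eventually.of_forall fun y => ?_, hLam.congr (Eventually.of_forall fun y => ?_)⟩
    · refine Integrable.of_bound
        (measurable_damping_right β hf y).ennreal_toReal.aestronglyMeasurable 1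
        (Eventually.of_forall fun m => ?_)
      rw [Real.norm_eq_abs, abs_of_nonneg ENNReal.toReal_nonneg]
      exact ENNReal.toReal_le_of_le_ofReal zero_le_one (by simpa using damping_le_one β f y m)
    · have h1 := tiltedKernel_real_mul_exp h β hf hQ y MeasurableSet.univ
      have := isMarkovKernel_tiltedKernel h β hf hQ
      rw [probReal_univ, one_mul, Measure.restrict_univ] at h1
      simp only [Real.norm_eq_abs, abs_of_nonneg ENNReal.toReal_nonneg]
      rw [h1, integral_toReal (measurable_damping_right β hf y).aemeasurable
        (Eventually.of_forall fun m => (damping_le_one β f y m).trans_lt ENNReal.one_lt_top)]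
  refine (hdamp.const_mul (∏ i, (Real.pi⁻¹ * Real.exp ((x i - μ * Δ) * β)))).mono'
    (measurable_augmented μ Δ β hf x).aestronglyMeasurable ?_
  have hae : ∀ᵐ p ∂((volume.restrict (Set.Ici (0 : Fin n → ℝ))).prod Q),
      ∀ i, lin (f i) p.2 < ∞ :=
    Measure.quasiMeasurePreserving_snd.ae (ae_all_iff.2 hQ)
  filter_upwards [hae] with p hp
  rw [damping_of_lt_top hp,
    ENNReal.toReal_ofReal (Finset.prod_nonneg fun i _ => (Real.exp_pos _).le)]
  exact abs_augmented_le μ Δ β f x p.1 p.2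

/-- Fubini for a general `ρ`, used for Lebesgue measure both on boxes and on the whole orthant. -/
lemma setIntegral_tiltedKernel_mul_weight (h : IsPoissonLaw ν Q) (μ Δ β : ℝ)
    {f : Fin n → V → ℝ≥0} (hf : ∀ i, Measurable (f i)) (hQ : ∀ i, ∀ᵐ m ∂Q, lin (f i) m < ∞)
    (x : Fin n → ℝ) {ρ : Measure (Fin n → ℝ)} [SFinite ρ]
    (hint : Integrable (Function.uncurry (augmented μ Δ β f x)) (ρ.prod Q))
    {B : Set (BFMeasure V)} (hB : MeasurableSet B) :
    ∫ y, (tiltedKernel Q β f y).real B * weight ν μ Δ β f x y ∂ρ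
      = ∫ m in B, ∫ y, augmented μ Δ β f x y m ∂ρ ∂Q := by
  simp_rw [← setIntegral_augmented h μ Δ β hf hQ x _ hB]
  refine integral_integral_swap ?_
  have h1 : ρ.prod (Q.restrict B) = (ρ.prod Q).restrict (Set.univ ×ˢ B) := by
    rw [← Measure.prod_restrict, Measure.restrict_univ]
  rw [h1]
  exact hint.restrict

/-- The posterior law of the random measure given the data `x`. -/
def posterior (Q : Measure (BFMeasure V)) [SFinite Q] (μ Δ β : ℝ) (f : Fin n → V → ℝ≥0) :
    Kernel (Fin n → ℝ) (BFMeasure V) :=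
  posteriorKernel Q fun x m => ENNReal.ofReal (condDensity μ Δ β f x m)

lemma likelihood_pos (μ Δ β : ℝ) {f : Fin n → V → ℝ≥0}
    (hτ : ∀ i, ∀ᵐ m ∂Q, 0 < lin (f i) m ∧ lin (f i) m < ∞) {x : Fin n → ℝ}
    (hint : Integrable (condDensity μ Δ β f x) Q) : 0 < likelihood Q μ Δ β f x := by
  refine (integral_pos_iff_support_of_nonneg (condDensity_nonneg μ Δ β f x) hint).2 ?_
  have h1 : Function.support (condDensity μ Δ β f x) =ᵐ[Q] Set.univ := by
    rw [eventuallyEq_univ]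
    filter_upwards [ae_all_iff.2 hτ] with m hm using (condDensity_pos μ Δ β x hm).ne'
  rw [measure_congr h1, measure_univ]
  exact one_pos

lemma posterior_real_apply (μ Δ β : ℝ) {f : Fin n → V → ℝ≥0} (hf : ∀ i, Measurable (f i))
    (hτ : ∀ i, ∀ᵐ m ∂Q, 0 < lin (f i) m ∧ lin (f i) m < ∞) {x : Fin n → ℝ}
    (hint : Integrable (condDensity μ Δ β f x) Q) {B : Set (BFMeasure V)} (hB : MeasurableSet B) :
    (posterior Q μ Δ β f x).real B
      = (∫ m in B, condDensity μ Δ β f x m ∂Q) / likelihood Q μ Δ β f x := by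
  have hL := likelihood_pos μ Δ β hτ hint
  have h1 : ∫⁻ m, ENNReal.ofReal (condDensity μ Δ β f x m) ∂Q
      = ENNReal.ofReal (likelihood Q μ Δ β f x) :=
    (ofReal_integral_eq_lintegral_ofReal hint
      (Eventually.of_forall (condDensity_nonneg μ Δ β f x))).symm
  have h2 : ∫⁻ m in B, ENNReal.ofReal (condDensity μ Δ β f x m) ∂Q
      = ENNReal.ofReal (∫ m in B, condDensity μ Δ β f x m ∂Q) :=
    (ofReal_integral_eq_lintegral_ofReal hint.restrict
      (Eventually.of_forall (condDensity_nonneg μ Δ β f x))).symm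
  have h3 : 0 ≤ ∫ m in B, condDensity μ Δ β f x m ∂Q :=
    integral_nonneg (condDensity_nonneg μ Δ β f x)
  rw [measureReal_def, posterior, posteriorKernel_apply_of_ne Q
    (measurable_condDensity μ Δ β hf).ennreal_ofReal _ _ hB, h1, h2, ENNReal.toReal_mul,
    ENNReal.toReal_inv, ENNReal.toReal_ofReal hL.le, ENNReal.toReal_ofReal h3]
  · field_simp
  · rw [h1]
    simpa using hL
  · rw [h1]
    exact ENNReal.ofReal_ne_top

lemma mul_mixDensity (ν : Measure V) (Q : Measure (BFMeasure V)) (μ Δ β : ℝ)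
    (f : Fin n → V → ℝ≥0) (x y : Fin n → ℝ) (r : ℝ) :
    r * mixDensity ν Q μ Δ β f x y
      = r * weight ν μ Δ β f x y / likelihood Q μ Δ β f x := by
  rw [mixDensity, mul_div_assoc]

lemma integrable_condDensity_of_ne (μ Δ β : ℝ) {f : Fin n → V → ℝ≥0}
    (hf : ∀ i, Measurable (f i))
    (hτ : ∀ i, ∀ᵐ m ∂Q, 0 < lin (f i) m ∧ lin (f i) m < ∞) {x : Fin n → ℝ}
    (hx : ∀ i, x i ≠ μ * Δ) : Integrable (condDensity μ Δ β f x) Q := by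
  refine Integrable.of_bound
    ((measurable_condDensity μ Δ β hf).comp measurable_prodMk_left).aestronglyMeasurable
    (∏ i, (Real.pi⁻¹ * Real.exp ((x i - μ * Δ) * β) * |x i - μ * Δ|⁻¹)) ?_
  filter_upwards [ae_all_iff.2 hτ] with m hm
  rw [Real.norm_eq_abs, abs_of_nonneg (condDensity_nonneg μ Δ β f x m)]
  exact condDensity_le μ Δ β hx hm

/-- The posterior law as an improper mixture of tilted Poisson laws. -/
lemma tendsto_setIntegral_Icc_mixDensity (h : IsPoissonLaw ν Q) (μ Δ β : ℝ)
    {f : Fin n → V → ℝ≥0} (hf : ∀ i, Measurable (f i))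
    (hτ : ∀ i, ∀ᵐ m ∂Q, 0 < lin (f i) m ∧ lin (f i) m < ∞) {x : Fin n → ℝ}
    (hx : ∀ i, x i ≠ μ * Δ) {B : Set (BFMeasure V)} (hB : MeasurableSet B) :
    Tendsto (fun R : Fin n → ℝ => ∫ y in Set.Icc 0 R,
      (tiltedKernel Q β f y).real B * mixDensity ν Q μ Δ β f x y) atTop
      (𝓝 ((posterior Q μ Δ β f x).real B)) := by
  have hQ : ∀ i, ∀ᵐ m ∂Q, lin (f i) m < ∞ := fun i => (hτ i).mono fun m hm => hm.2
  rw [posterior_real_apply μ Δ β hf hτ (integrable_condDensity_of_ne μ Δ β hf hτ hx) hB]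
  simp_rw [mul_mixDensity, integral_div]
  refine Tendsto.div_const ?_ _
  have hfin : ∀ R : Fin n → ℝ, Integrable (Function.uncurry (augmented μ Δ β f x))
      ((volume.restrict (Set.Icc 0 R)).prod Q) := fun R => by
    have : IsFiniteMeasure ((volume : Measure (Fin n → ℝ)).restrict (Set.Icc 0 R)) :=
      ⟨by simpa using isCompact_Icc.measure_lt_top⟩
    exact integrable_augmented_of_isFiniteMeasure Q _ μ Δ β hf x
  simp_rw [fun R : Fin n → ℝ => setIntegral_tiltedKernel_mul_weight h μ Δ β hf hQ x (hfin R) hB]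
  -- After the exchange, the inner box integrals converge to the conditional density for almost
  -- every `m`, dominated by a constant, which is integrable for the probability measure `Q`.
  have := isCountablyGenerated_atTop_pi n
  refine tendsto_integral_filter_of_dominated_convergence
    (fun _ => ∏ i, (Real.pi⁻¹ * Real.exp ((x i - μ * Δ) * β) * |x i - μ * Δ|⁻¹)) ?_ ?_
    (integrable_const _) ?_
  · exact Eventually.of_forall fun R => (hfin R).integral_prod_right.aestronglyMeasurable.restrict
  · filter_upwards [eventually_ge_atTop 0] with R hR
    exact Eventually.of_forall fun m => abs_setIntegral_Icc_augmented_le μ Δ β f hx m hR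
  · refine ae_restrict_of_ae ?_
    filter_upwards [ae_all_iff.2 hτ] with m hm
    exact tendsto_setIntegral_Icc_augmented μ Δ β x hm

/-- The posterior law as an absolutely convergent mixture of tilted Poisson laws. -/
lemma posterior_mixture_of_integrableOn (h : IsPoissonLaw ν Q) (μ Δ β : ℝ)
    {f : Fin n → V → ℝ≥0} (hf : ∀ i, Measurable (f i))
    (hτ : ∀ i, ∀ᵐ m ∂Q, 0 < lin (f i) m ∧ lin (f i) m < ∞)
    (hLam : IntegrableOn (fun y : Fin n → ℝ => Real.exp (-Lam ν (Omega β f y))) (Set.Ici 0))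
    (x : Fin n → ℝ) :
    0 < likelihood Q μ Δ β f x ∧
      IntegrableOn (fun y => mixDensity ν Q μ Δ β f x y) (Set.Ici 0) ∧
      ∀ B, MeasurableSet B → (posterior Q μ Δ β f x).real B
        = ∫ y in Set.Ici 0, (tiltedKernel Q β f y).real B * mixDensity ν Q μ Δ β f x y := by
  have hQ : ∀ i, ∀ᵐ m ∂Q, lin (f i) m < ∞ := fun i => (hτ i).mono fun m hm => hm.2
  have := isMarkovKernel_tiltedKernel h β hf hQ
  have haug := integrable_augmented_Ici h μ Δ β hf hQ x hLam
  have hae : (fun m => ∫ y in Set.Ici 0, augmented μ Δ β f x y m)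
      =ᵐ[Q] condDensity μ Δ β f x := by
    filter_upwards [ae_all_iff.2 hτ] with m hm using setIntegral_Ici_augmented μ Δ β x hm
  have hint : Integrable (condDensity μ Δ β f x) Q := haug.integral_prod_right.congr hae
  refine ⟨likelihood_pos μ Δ β hτ hint, ?_, fun B hB => ?_⟩
  · refine (haug.integral_prod_left.div_const (likelihood Q μ Δ β f x)).congr
      (Eventually.of_forall fun y => ?_)
    have h1 := setIntegral_augmented h μ Δ β hf hQ x y MeasurableSet.univ
    rw [probReal_univ, one_mul, Measure.restrict_univ] at h1
    simp only [mixDensity, Function.uncurry_apply_pair, h1]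
  · rw [posterior_real_apply μ Δ β hf hτ hint hB]
    simp_rw [mul_mixDensity, integral_div]
    rw [setIntegral_tiltedKernel_mul_weight h μ Δ β hf hQ x haug hB]
    congr 1
    exact integral_congr_ae (ae_restrict_of_ae hae.symm)

end

end PoissonSV

end

/-! ### The theorem. -/

theorem theorem2p2 {V : Type*} [MetricSpace V] [CompleteSpace V] [SecondCountableTopology V]
    [MeasurableSpace V] [BorelSpace V]
    {S : Type*} [MeasurableSpace S] (P : Measure S) [IsProbabilityMeasure P]
    (n : ℕ) (μ Δ β : ℝ)
    -- a boundedly finite intensity and the functions `f_1, …, f_n`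
    (ν : Measure V) (hν : ∀ s : Set V, Bornology.IsBounded s → ν s < ∞)
    (f : Fin n → V → ℝ≥0) (hf : ∀ i, Measurable (f i))
    -- the Poisson random measure `N` and the data `X`
    (N : S → PoissonSV.BFMeasure V) (hN : Measurable N)
    (hNν : PoissonSV.IsPoissonLaw ν (P.map N))
    (hτ : ∀ i, ∀ᵐ ω ∂P, 0 < PoissonSV.lin (f i) (N ω) ∧ PoissonSV.lin (f i) (N ω) < ∞)
    (X : S → Fin n → ℝ) (hX : HasCondDistrib X N (PoissonSV.sampling μ Δ β f hf) P) :
    -- `K y` is the Poisson law with tilted intensity, `κ x` the posterior law of `N` given `X = x`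
    ∃ (K κ : Kernel (Fin n → ℝ) (PoissonSV.BFMeasure V)),
      IsMarkovKernel K ∧ IsMarkovKernel κ ∧
      (∀ y, PoissonSV.IsPoissonLaw (PoissonSV.tilt ν (PoissonSV.Omega β f y)) (K y)) ∧
      HasCondDistrib N X κ P ∧
      HasCondDistrib (fun ω i => PoissonSV.lin (f i) (N ω)) X
        (κ.map (fun m i => PoissonSV.lin (f i) m)) P ∧
      -- the mixture representation, as an improper integral, for almost all data
      (∀ᵐ x ∂(P.map X), ∀ i, x i ≠ μ * Δ) ∧
      (∀ x : Fin n → ℝ, (∀ i, x i ≠ μ * Δ) →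
        0 < PoissonSV.likelihood (P.map N) μ Δ β f x ∧
        ∀ B, MeasurableSet B →
          Tendsto (fun R : Fin n → ℝ => ∫ y in Set.Icc 0 R,
              (K y).real B * PoissonSV.mixDensity ν (P.map N) μ Δ β f x y)
            atTop (𝓝 ((κ x).real B))) ∧
      -- the mixture representation, as a Lebesgue integral, for all data
      (IntegrableOn (fun y : Fin n → ℝ =>
          Real.exp (-PoissonSV.Lam ν (PoissonSV.Omega β f y))) (Set.Ici 0) →
        ∀ x : Fin n → ℝ,
          0 < PoissonSV.likelihood (P.map N) μ Δ β f x ∧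
          IntegrableOn (fun y => PoissonSV.mixDensity ν (P.map N) μ Δ β f x y) (Set.Ici 0) ∧
          ∀ B, MeasurableSet B →
            (κ x).real B = ∫ y in Set.Ici 0,
              (K y).real B * PoissonSV.mixDensity ν (P.map N) μ Δ β f x y) ∧
      -- `y` as an auxiliary variable: integrating it out gives the model, and `K y` is the
      -- posterior law of `N` given `x` and `y`
      (∀ x : Fin n → ℝ, ∀ᵐ m ∂(P.map N),
        IntegrableOn (fun y => PoissonSV.augmented μ Δ β f x y m) (Set.Ici 0) ∧
        ∫ y in Set.Ici 0, PoissonSV.augmented μ Δ β f x y m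
          = PoissonSV.condDensity μ Δ β f x m) ∧
      (∀ (x y : Fin n → ℝ) (B : Set (PoissonSV.BFMeasure V)), MeasurableSet B →
        ∫ m in B, PoissonSV.augmented μ Δ β f x y m ∂(P.map N)
          = (K y).real B * PoissonSV.weight ν μ Δ β f x y) := by
  have : IsProbabilityMeasure (P.map N) := Measure.isProbabilityMeasure_map hN.aemeasurable
  -- Balls are bounded, so `ν` is locally finite; second countability then makes it σ-finite, as the
  -- Laplace functional requires.
  have : IsLocallyFiniteMeasure ν :=
    ⟨fun x => ⟨Metric.ball x 1, Metric.ball_mem_nhds x one_pos, hν _ Metric.isBounded_ball⟩⟩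
  have hτ' : ∀ i, ∀ᵐ m ∂(P.map N), 0 < PoissonSV.lin (f i) m ∧ PoissonSV.lin (f i) m < ∞ := by
    intro i
    have hl := PoissonSV.measurable_lin (hf i)
    refine (ae_map_iff hN.aemeasurable ?_).2 (hτ i)
    exact (hl measurableSet_Ioi).inter (hl measurableSet_Iio)
  have hQ : ∀ i, ∀ᵐ m ∂(P.map N), PoissonSV.lin (f i) m < ∞ := fun i =>
    (hτ' i).mono fun m hm => hm.2
  have hc := (PoissonSV.measurable_condDensity μ Δ β hf).ennreal_ofReal
  have hs : ∀ᵐ m ∂(P.map N), PoissonSV.sampling μ Δ β f hf m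
      = volume.withDensity fun x => ENNReal.ofReal (PoissonSV.condDensity μ Δ β f x m) := by
    filter_upwards [ae_all_iff.2 hτ'] with m hm
    exact PoissonSV.sampling_eq_withDensity μ Δ β hf hm
  have hpost : IsMarkovKernel (PoissonSV.posterior (P.map N) μ Δ β f) :=
    PoissonSV.isMarkovKernel_posteriorKernel _ hc
  have hcond : HasCondDistrib N X (PoissonSV.posterior (P.map N) μ Δ β f) P :=
    PoissonSV.hasCondDistrib_posteriorKernel hc hX hs
  refine ⟨PoissonSV.tiltedKernel (P.map N) β f, PoissonSV.posterior (P.map N) μ Δ β f,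
    PoissonSV.isMarkovKernel_tiltedKernel hNν β hf hQ, hpost,
    PoissonSV.isPoissonLaw_tiltedKernel hNν β hf hQ, hcond,
    hcond.comp_left (measurable_pi_lambda _ fun i => PoissonSV.measurable_lin (hf i)), ?_, ?_,
    PoissonSV.posterior_mixture_of_integrableOn hNν μ Δ β hf hτ', ?_, ?_⟩
  -- The law of `X` has a Lebesgue density, so it does not charge the hyperplanes `x_i = μΔ`.
  · rw [PoissonSV.map_eq_withDensity_of_density hc hX hs]
    refine (withDensity_absolutelyContinuous _ _).ae_le (ae_all_iff.2 fun i => ?_)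
    exact Measure.ae_eval_ne (α := fun _ : Fin n => ℝ) (fun _ => volume) i (μ * Δ)
  · intro x hx
    exact ⟨PoissonSV.likelihood_pos μ Δ β hτ'
      (PoissonSV.integrable_condDensity_of_ne μ Δ β hf hτ' hx),
      fun B hB => PoissonSV.tendsto_setIntegral_Icc_mixDensity hNν μ Δ β hf hτ' hx hB⟩
  · intro x
    filter_upwards [ae_all_iff.2 hτ'] with m hm
    exact ⟨PoissonSV.integrableOn_augmented μ Δ β x hm,
      PoissonSV.setIntegral_Ici_augmented μ Δ β x hm⟩
  · intro x y B hB
    exact PoissonSV.setIntegral_augmented hNν μ Δ β hf hQ x y hB
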